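/- **Labelled spaces.** Let $\mathcal E=(\mathcal E^0,\mathcal E^1,r,s)$ be a directed graph with non-empty sets of vertices and edges, $\mathcal L:\mathcal E^1\to\mathcal A$ a surjective labelling map, extended letter by letter to paths, and $\mathcal L^*$ the set of labels of finite paths together with the empty word $\omega$. For $A\subseteq\mathcal E^0$ put $r(A,\omega)=A$ and, for $\alpha\neq\omega$, $r(A,\alpha)=\{r(\lambda):\lambda$ a path, $\mathcal L(\lambda)=\alpha$, $s(\lambda)\in A\}$; put $r(\alpha)=r(\mathcal E^0,\alpha)$. Let $\mathcal B$ be a family of subsets of $\mathcal E^0$ that is closed under finite unions, finite intersections and relative ranges $r(\cdot,\alpha)$ ($\alpha\in\mathcal L^*$) and contains $r(\alpha)$ for all $\alpha\in\mathcal L^*\setminus\{\omega\}$. Assume that the labelled space $(\mathcal E,\mathcal L,\mathcal B)$ is *weakly left-resolving* ($r(A\cap B,\alpha)=r(A,\alpha)\cap r(B,\alpha)$ for $A,B\in\mathcal B$ and $\alpha\in\mathcal L^*\setminus\{\omega\}$) and *normal* ($\mathcal B$ is closed under relative complements). Put $\mathcal B_\alpha=\{A\in\mathcal B: A\subseteq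 r(\alpha)\}$. **Inverse semigroup.** Let $S=\{(\alpha,A,\beta):\alpha,\beta\in\mathcal L^*,\ \emptyset\ne A\in\mathcal B_\alpha\cap\mathcal B_\beta\}\cup\{0\}$, with $(\alpha,A,\beta)^*=(\beta,A,\alpha)$ and with $(\alpha,A,\beta)(\gamma,B,\delta)$ equal to $(\alpha\gamma',r(A,\gamma')\cap B,\delta)$ if $\gamma=\beta\gamma'$, and to $(\alpha,A\cap r(B,\beta'),\delta\beta')$ if $\beta=\gamma\beta'$ (in both cases if the middle entry is non-empty), and to $0$ otherwise. Its semilattice of idempotents is $E(S)=\{(\alpha,A,\alpha)\in S\}\cup\{0\}$. **Tight filters.** Characters of $E(S)$ (non-zero maps $E(S)\to\{0,1\}$ preserving products and zero) carry the topology of pointwise convergence, and $\phi$ corresponds to the filter $\{e:\phi(e)=1\}$. The tight spectrum $\hat E_{tight}$ is the closure, in the space of characters, of the set of characters corresponding to ultrafilters; the corresponding filters are the tight filters, and $\mathsf T$ is the set of them. The word associated with a filter $\xi$ is the finite or infinite word $\alpha$ whose non-empty finite beginnings are the non-empty $\beta$ with $(\beta,A,\beta)\in\xi$ for some $A$; put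 $\xi_n=\{A:(\alpha_{1,n},A,\alpha_{1,n})\in\xi\}$ for integers $0\le n\le|\alpha|$, where $\alpha_{1,n}$ is the beginning of $\alpha$ of length $n$. We write $\xi^\alpha$ to indicate the word; $\xi$ is determined by $\alpha$ and $(\xi_n)_n$. **Cutting and gluing.** Let $\alpha$ be a finite word and $\beta$ a finite or infinite word. $H_{[\omega]\beta}$ and $G_{(\omega)\beta}$ are identity maps. For $\alpha\ne\omega$, $H_{[\alpha]\beta}$ sends a tight filter $\xi^{\alpha\beta}$ to the tight filter $\eta^\beta$ with $\eta_n=\{C\in\mathcal B_{\beta_{1,n}}:D\subseteq C\text{ for some }D\in\xi_{n+|\alpha|}\}$ for $0\le n\le|\beta|$. For $\alpha\neq\omega$, $G_{(\alpha)\beta}$ sends a tight filter $\xi^\beta$ with $r(\alpha)\in\xi_0$ to the tight filter $\eta^{\alpha\beta}$ defined as follows. If $\beta\ne\omega$, then $\eta_{|\alpha|+n}=\{C\cap r(\alpha\beta_{1,n}):C\in\xi_n\}$ for $1\le n\le|\beta|$ and $\eta_i=\{D\in\mathcal B_{\alpha_{1,i}}:r(D,\alpha_{i+1}\cdots\alpha_{|\alpha|}\beta_1)\in\eta_{|\alpha|+1}\}$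 for $0\le i\le|\alpha|$. If $\beta=\omega$, then $\eta_{|\alpha|}=\{C\cap r(\alpha):C\in\xi_0\}$ and $\eta_i=\{D\in\mathcal B_{\alpha_{1,i}}:r(D,\alpha_{i+1}\cdots\alpha_{|\alpha|})\in\eta_{|\alpha|}\}$ for $0\le i<|\alpha|$. **The groupoids.** Let $$\Gamma=\{(\xi^{\alpha\gamma},|\alpha|-|\beta|,\eta^{\beta\gamma})\in\mathsf T\times\mathbb Z\times\mathsf T:\ H_{[\alpha]\gamma}(\xi)=H_{[\beta]\gamma}(\eta)\},$$ a groupoid with product $(\xi,m,\eta)(\eta,n,\rho)=(\xi,m+n,\rho)$ and inverse $(\xi,m,\eta)^{-1}=(\eta,-m,\xi)$. For $e\in E(S)$ let $D_e=\{\phi\in\hat E_{tight}:\phi(e)=1\}$, and let $\mathcal G_{tight}$ be the set of germs $[s,\phi]$, i.e. of classes of pairs $(s,\phi)$ with $s\in S$ and $\phi\in D_{s^*s}$, where $(s,\phi)\sim(t,\psi)$ iff $\phi=\psi$ and $se=te$ for some $e\in E(S)$ with $\phi\in D_e$. Its topology is generated by the sets $\Theta(s,U)=\{[s,\phi]:\phi\in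 U\}$ with $s\in S$ and $U\subseteq D_{s^*s}$ open. For $s=(\mu,A,\nu)\in S\setminus\{0\}$, $e\in E(S)$ and a finite, possibly empty set $\{e_1,\dots,e_n\}\subseteq E(S)$ put $$Z_{s,e:e_1,\dots,e_n}=\{(\eta^{\mu\gamma},|\mu|-|\nu|,\xi^{\nu\gamma})\in\Gamma:\ e\in\xi,\ e_1,\dots,e_n\notin\xi,\ H_{[\mu]\gamma}(\eta)=H_{[\nu]\gamma}(\xi)\}$$ and $Z_s=Z_{s,s^*s}$ (with $n=0$). **Claim.** There is a bijection $\Phi:\mathcal G_{tight}\to\Gamma$ given by $$\Phi[t,\phi]=\big((G_{(\beta)\alpha'}\circ H_{[\gamma]\alpha'})(\xi),\ |\beta|-|\gamma|,\ \xi\big),$$ where $t=(\beta,A,\gamma)$, $\xi$ is the filter corresponding to $\phi$, and $\gamma\alpha'$ is the word associated with $\xi$. For the topology on $\Gamma$ transported through $\Phi$ from $\mathcal G_{tight}$: 1. the sets $Z_{s,e:e_1,\dots,e_n}$ are compact and open, and they form a basis of the topology; 2. $\Gamma$ is an étale groupoid: product and inverse are continuous, the unit space is locally compact and Hausdorff,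 and the range map onto the unit space is a local homeomorphism; 3. for every $s\in S\setminus\{0\}$ the set $Z_s$ is a compact open bisection: it is compact and open, and the source and range maps restrict to homeomorphisms from $Z_s$ onto open subsets of the unit space. -/

import Mathlib

/-! ## Finite and infinite words -/

/-- A finite or infinite word over an alphabet. -/
inductive LWord (Alph : Type*) where
  | fin (l : List Alph) : LWord Alph
  | inf (x : Stream' Alph) : LWord Alph

namespace LWord

variable {Alph : Type*}

/-- The concatenation `α γ` of a finite word with a finite or infinite word. -/
def append (α : List Alph) : LWord Alph → LWord Alph
  | fin l => fin (α ++ l)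
  | inf x => inf (Stream'.appendStream' α x)

/-- The length of a word. -/
def length : LWord Alph → ℕ∞
  | fin l => (l.length : ℕ∞)
  | inf _ => ⊤

/-- The beginning `w_{1,n}` (used for `n ≤ |w|`). -/
def take (n : ℕ) : LWord Alph → List Alph
  | fin l => l.take n
  | inf x => Stream'.take n x

/-- `β` is a beginning of `w`. -/
def IsBeginning (β : List Alph) (w : LWord Alph) : Prop := ∃ w', w = append β w'

theorem append_nil (w : LWord Alph) : append [] w = w := by
  cases w <;> simp [append, Stream'.nil_append_stream]

theorem append_append (α β : List Alph) (w : LWord Alph) :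
    append (α ++ β) w = append α (append β w) := by
  cases w <;> simp [append, Stream'.append_append_stream]

theorem append_cons_inj {a b : Alph} {α β : List Alph} {w w' : LWord Alph}
    (h : append (a :: α) w = append (b :: β) w') : a = b ∧ append α w = append β w' := by
  cases w with
  | fin l =>
    cases w' with
    | fin l' => simpa [append] using h
    | inf x' => simp [append] at h
  | inf x =>
    cases w' with
    | fin l' => simp [append] at h
    | inf x' =>
      simp only [append, inf.injEq, Stream'.cons_append_stream] at h
      obtain ⟨h1, h2⟩ := Stream'.cons_injective2 h
      exact ⟨h1, by simp [append, h2]⟩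

theorem append_cancel (α : List Alph) {w w' : LWord Alph} (h : append α w = append α w') :
    w = w' := by
  induction α with
  | nil => simpa [append_nil] using h
  | cons a α ih => exact ih (append_cons_inj h).2

theorem comparable_of_append_eq (α β : List Alph) {w w' : LWord Alph}
    (h : append α w = append β w') :
    (∃ δ, β = α ++ δ ∧ w = append δ w') ∨ (∃ δ, α = β ++ δ ∧ w' = append δ w) := by
  induction α generalizing β with
  | nil => exact Or.inl ⟨β, rfl, by simpa [append_nil] using h⟩
  | cons a α ih =>
    cases β with
    | nil => exact Or.inr ⟨a :: α, rfl, by simpa [append_nil] using h.symm⟩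
    | cons b β =>
      obtain ⟨rfl, h2⟩ := append_cons_inj h
      rcases ih β h2 with ⟨δ, rfl, hw⟩ | ⟨δ, rfl, hw⟩
      · exact Or.inl ⟨δ, rfl, hw⟩
      · exact Or.inr ⟨δ, rfl, hw⟩

theorem length_append (α : List Alph) (w : LWord Alph) :
    (append α w).length = (α.length : ℕ∞) + w.length := by
  cases w <;> simp [append, length]

theorem take_append (α : List Alph) (w : LWord Alph) (n : ℕ) :
    (append α w).take (n + α.length) = α ++ w.take n := by
  cases w with
  | fin l => simp [append, take, List.take_append]
  | inf x =>
    simp only [append, take]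
    induction α with
    | nil => simp [Stream'.nil_append_stream]
    | cons a α ih =>
      rw [Stream'.cons_append_stream, List.length_cons, ← Nat.add_assoc, Stream'.take_succ_cons, ih]
      rfl

theorem length_take {w : LWord Alph} {n : ℕ} (h : (n : ℕ∞) ≤ w.length) :
    (w.take n).length = n := by
  cases w with
  | fin l =>
    have : n ≤ l.length := by simpa [length] using h
    simp [take, this]
  | inf x => simp [take, Stream'.length_take]

theorem isBeginning_take (w : LWord Alph) (n : ℕ) : IsBeginning (w.take n) w := by
  cases w with
  | fin l => exact ⟨fin (l.drop n), by simp [append, take]⟩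
  | inf x => exact ⟨inf (x.drop n), by simp [append, take, Stream'.append_take_drop]⟩

theorem IsBeginning.eq_take {β : List Alph} {w : LWord Alph} (h : IsBeginning β w) :
    (β.length : ℕ∞) ≤ w.length ∧ w.take β.length = β := by
  obtain ⟨w', rfl⟩ := h
  refine ⟨by simp [length_append], ?_⟩
  have := take_append β w' 0
  have h0 : w'.take 0 = [] := by cases w' <;> simp [take]
  simpa [h0] using this

theorem eq_of_isBeginning_iff {w w' : LWord Alph}
    (h : ∀ β, IsBeginning β w ↔ IsBeginning β w') : w = w' := by
  have key : ∀ n : ℕ, (n : ℕ∞) ≤ w.length →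
      (n : ℕ∞) ≤ w'.length ∧ w'.take n = w.take n := by
    intro n hn
    have := ((h _).1 (isBeginning_take w n)).eq_take
    rwa [length_take hn] at this
  have key2 : ∀ n : ℕ, (n : ℕ∞) ≤ w'.length → (n : ℕ∞) ≤ w.length := by
    intro n hn
    have := ((h _).2 (isBeginning_take w' n)).eq_take
    rw [length_take hn] at this
    exact this.1
  cases w with
  | fin l =>
    cases w' with
    | fin l' =>
      have h1 := key l.length (by simp [length])
      have h2 := key2 l'.length (by simp [length])
      simp only [length, take, Nat.cast_le] at h1 h2
      have h3 : l.length = l'.length := le_antisymm h1.1 h2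
      have h4 := h1.2
      rw [List.take_length, h3, List.take_length] at h4
      rw [h4]
    | inf x' =>
      have := key2 (l.length + 1) (by simp [length])
      simp only [length, Nat.cast_le] at this
      omega
  | inf x =>
    cases w' with
    | fin l' =>
      have := (key (l'.length + 1) (by simp [length])).1
      simp only [length, Nat.cast_le] at this
      omega
    | inf x' =>
      have : x = x' := Stream'.take_theorem _ _ fun n => (key n (by simp [length])).2.symm
      rw [this]

end LWord

/-! ## Filters, characters and the tight spectrum of a semilattice with zero

The meet of the semilattice is written as a product, so `e ≤ f` means `e * f = e`. -/

section Semilattice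

variable {E : Type*} [Mul E] [Zero E]

/-- A (proper, nonempty) filter. -/
structure IsSemilatticeFilter (ξ : Set E) : Prop where
  nonempty : ξ.Nonempty
  zero_notMem : (0 : E) ∉ ξ
  mul_mem : ∀ e ∈ ξ, ∀ f ∈ ξ, e * f ∈ ξ
  upper : ∀ e ∈ ξ, ∀ f, e * f = e → f ∈ ξ

/-- An ultrafilter: a maximal filter. -/
def IsSemilatticeUltrafilter (ξ : Set E) : Prop :=
  IsSemilatticeFilter ξ ∧ ∀ ζ, IsSemilatticeFilter ζ → ξ ⊆ ζ → ζ = ξ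

/-- A character: a nonzero map to the Boolean algebra `{0, 1}` that preserves zero and meets. -/
structure IsSemilatticeCharacter (φ : E → Bool) : Prop where
  map_zero : φ 0 = false
  map_mul : ∀ e f, φ (e * f) = (φ e && φ f)
  nonzero : ∃ e, φ e = true

variable (E) in
/-- The space of characters, with the topology of pointwise convergence. -/
abbrev CharacterSpace : Type _ := {φ : E → Bool // IsSemilatticeCharacter φ}

/-- The filter associated with a character. -/
def CharacterSpace.filter (φ : CharacterSpace E) : Set E := {e | φ.1 e = true}

variable (E) in
/-- The tight spectrum: the closure, in the space of characters, of the set of characters that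
correspond to ultrafilters. -/
def tightSpectrum : Set (CharacterSpace E) :=
  closure {φ | IsSemilatticeUltrafilter φ.filter}

variable (E) in
/-- The set of tight filters: the filters associated with tight characters. -/
abbrev TightFilter : Type _ := {ξ : Set E // ∃ φ ∈ tightSpectrum E, φ.filter = ξ}

end Semilattice

/-! ## Topological groupoids -/

/-- A groupoid, given by its set of arrows `G`, the relation of composability, the partial product
and the inverse. -/
structure ArrowGroupoid (G : Type*) where
  Comp : G → G → Prop
  mul : ∀ g h, Comp g h → G
  inv : G → G
  inv_inv : ∀ g, inv (inv g) = g
  mul_assoc : ∀ g h k (p : Comp g h) (q : Comp h k),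
    ∃ (p' : Comp (mul g h p) k) (q' : Comp g (mul h k q)),
      mul (mul g h p) k p' = mul g (mul h k q) q'
  inv_comp : ∀ g, Comp (inv g) g
  comp_inv : ∀ g, Comp g (inv g)
  inv_mul_cancel : ∀ g h (p : Comp g h),
    ∃ q : Comp (inv g) (mul g h p), mul (inv g) (mul g h p) q = h
  mul_inv_cancel : ∀ h g (p : Comp h g),
    ∃ q : Comp (mul h g p) (inv g), mul (mul h g p) (inv g) q = h

namespace ArrowGroupoid

variable {G : Type*} (𝒢 : ArrowGroupoid G)

/-- The source `g⁻¹ g`. -/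
def src (g : G) : G := 𝒢.mul (𝒢.inv g) g (𝒢.inv_comp g)

/-- The range `g g⁻¹`. -/
def rng (g : G) : G := 𝒢.mul g (𝒢.inv g) (𝒢.comp_inv g)

/-- The unit space, as a subset of the groupoid. -/
def units : Set G := Set.range 𝒢.src

theorem rng_eq_src_inv (g : G) : 𝒢.rng g = 𝒢.src (𝒢.inv g) := by
  have aux : ∀ g' (p : 𝒢.Comp g' (𝒢.inv g)), g' = g →
      𝒢.mul g (𝒢.inv g) (𝒢.comp_inv g) = 𝒢.mul g' (𝒢.inv g) p := by
    rintro _ p rfl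
    rfl
  exact aux _ _ (𝒢.inv_inv g)

/-- The source map as a map to the unit space. -/
def srcMap (g : G) : 𝒢.units := ⟨𝒢.src g, g, rfl⟩

/-- The range map as a map to the unit space. -/
def rngMap (g : G) : 𝒢.units := ⟨𝒢.rng g, 𝒢.inv g, (𝒢.rng_eq_src_inv g).symm⟩

/-- An étale groupoid: the product (on the set of composable pairs) and the inverse are continuous,
the unit space is locally compact and Hausdorff in the relative topology, and the range map to the
unit space is a local homeomorphism. -/
structure IsEtale [TopologicalSpace G] : Prop where
  continuous_mul :
    Continuous fun p : {p : G × G // 𝒢.Comp p.1 p.2} => 𝒢.mul p.1.1 p.1.2 p.2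
  continuous_inv : Continuous 𝒢.inv
  locallyCompact_units : LocallyCompactSpace 𝒢.units
  t2_units : T2Space 𝒢.units
  isLocalHomeomorph_rng : IsLocalHomeomorph 𝒢.rngMap

/-- An open bisection: an open set on which the source map and the range map are injective and
homeomorphisms onto open subsets of the unit space. -/
structure IsOpenBisection [TopologicalSpace G] (U : Set G) : Prop where
  isOpen : IsOpen U
  src_isOpenEmbedding : Topology.IsOpenEmbedding (U.domRestrict 𝒢.srcMap)
  rng_isOpenEmbedding : Topology.IsOpenEmbedding (U.domRestrict 𝒢.rngMap)

end ArrowGroupoid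

/-! ## Labelled spaces -/

/-- A directed graph with range and source maps `r`, `s`. -/
structure DirGraph (V Edge : Type*) where
  r : Edge → V
  s : Edge → V

/-- A labelled graph: a directed graph with nonempty sets of vertices and edges, and a surjective
labelling map. -/
structure LabelledGraph (V Edge Alph : Type*) extends DirGraph V Edge where
  nonempty_vertices : Nonempty V
  nonempty_edges : Nonempty Edge
  label : Edge → Alph
  label_surjective : Function.Surjective label

namespace LabelledGraph

variable {V Edge Alph : Type*} (X : LabelledGraph V Edge Alph)

/-- A list of edges `λ₁ … λₙ` is a path if `r(λᵢ) = s(λᵢ₊₁)`. -/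
def IsPath (l : List Edge) : Prop := l.IsChain fun e f => X.r e = X.s f

/-- The set of finite labelled paths, including the empty word. -/
def labelledPaths : Set (List Alph) :=
  {α | α = [] ∨ ∃ l : List Edge, l ≠ [] ∧ X.IsPath l ∧ l.map X.label = α}

/-- The relative range `r(A, α)`. -/
def relRange (A : Set V) (α : List Alph) : Set V :=
  {v | (α = [] ∧ v ∈ A) ∨
    ∃ (l : List Edge) (hl : l ≠ []), X.IsPath l ∧ l.map X.label = α ∧
      X.s (l.head hl) ∈ A ∧ X.r (l.getLast hl) = v}

/-- The range `r(α)`. -/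
def range (α : List Alph) : Set V := X.relRange Set.univ α

theorem relRange_nil (A : Set V) : X.relRange A [] = A := by
  ext v
  simp only [relRange, Set.mem_ofPred_eq, List.map_eq_nil_iff]
  constructor
  · rintro (h | ⟨l, hl, -, h, -⟩)
    · exact h.2
    · exact absurd h hl
  · exact fun h => Or.inl ⟨trivial, h⟩

theorem mem_labelledPaths_of_relRange {A : Set V} {α : List Alph}
    (h : (X.relRange A α).Nonempty) : α ∈ X.labelledPaths := by
  obtain ⟨v, h | ⟨l, hl, hp, hm, -⟩⟩ := h
  · exact Or.inl h.1
  · exact Or.inr ⟨l, hl, hp, hm⟩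

theorem relRange_subset_range_append {A : Set V} {α β : List Alph} (hA : A ⊆ X.range α) :
    X.relRange A β ⊆ X.range (α ++ β) := by
  rintro v (⟨rfl, hv⟩ | ⟨l, hl, hp, hm, hs, hr⟩)
  · rw [List.append_nil]
    exact hA hv
  · rcases hA hs with ⟨rfl, -⟩ | ⟨l', hl', hp', hm', -, hr'⟩
    · exact Or.inr ⟨l, hl, hp, by simpa using hm, Set.mem_univ _, hr⟩
    · refine Or.inr ⟨l' ++ l, by simp [hl], ?_, by simp [hm, hm'], trivial, ?_⟩
      · refine List.IsChain.append hp' hp ?_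
        intro x hx y hy
        rw [List.getLast?_eq_some_getLast hl'] at hx
        rw [List.head?_eq_some_head hl] at hy
        cases hx
        cases hy
        exact hr'
      · rw [List.getLast_append_of_ne_nil _ hl]
        exact hr

theorem mem_labelledPaths_right {α β : List Alph} (h : α ++ β ∈ X.labelledPaths) :
    β ∈ X.labelledPaths := by
  rcases h with h | ⟨l, hl, hp, hm⟩
  · exact Or.inl (List.append_eq_nil_iff.1 h).2
  · obtain ⟨l₁, l₂, rfl, h₁, h₂⟩ := List.map_eq_append_iff.1 hm
    by_cases h0 : l₂ = []
    · subst h0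
      exact Or.inl h₂.symm
    · exact Or.inr ⟨l₂, h0, (List.isChain_append.1 hp).2.1, h₂⟩

theorem range_append_subset (α β : List Alph) : X.range (α ++ β) ⊆ X.range β := by
  by_cases hβ : β = []
  · subst hβ
    intro v _
    exact Or.inl ⟨rfl, trivial⟩
  rintro v (⟨h, -⟩ | ⟨l, hl, hp, hm, -, hr⟩)
  · exact absurd (List.append_eq_nil_iff.1 h).2 hβ
  · obtain ⟨l₁, l₂, rfl, h₁, h₂⟩ := List.map_eq_append_iff.1 hm
    have h0 : l₂ ≠ [] := by
      rintro rfl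
      exact hβ h₂.symm
    refine Or.inr ⟨l₂, h0, (List.isChain_append.1 hp).2.1, h₂, trivial, ?_⟩
    rw [List.getLast_append_of_ne_nil _ h0] at hr
    exact hr

end LabelledGraph

/-- A labelled space: a labelled graph with a family `fam` of sets of vertices that is closed under
finite intersections and finite unions, contains all ranges of nonempty labelled paths and is closed
under relative ranges. -/
structure LabelledSpace (V Edge Alph : Type*) extends LabelledGraph V Edge Alph where
  fam : Set (Set V)
  inter_mem : ∀ A ∈ fam, ∀ B ∈ fam, A ∩ B ∈ fam
  union_mem : ∀ A ∈ fam, ∀ B ∈ fam, A ∪ B ∈ fam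
  range_mem : ∀ α ∈ toLabelledGraph.labelledPaths, α ≠ [] → toLabelledGraph.range α ∈ fam
  relRange_mem : ∀ A ∈ fam, ∀ α ∈ toLabelledGraph.labelledPaths,
    toLabelledGraph.relRange A α ∈ fam

namespace LabelledSpace

variable {V Edge Alph : Type*} (X : LabelledSpace V Edge Alph)

/-- Normality: the family is closed under relative complements. -/
def Normal : Prop := ∀ A ∈ X.fam, ∀ B ∈ X.fam, A \ B ∈ X.fam

/-- The labelled space is weakly left-resolving. -/
def WeaklyLeftResolving : Prop :=
  ∀ A ∈ X.fam, ∀ B ∈ X.fam, ∀ α ∈ X.labelledPaths, α ≠ [] →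
    X.relRange (A ∩ B) α = X.relRange A α ∩ X.relRange B α

/-- The members of the family that are contained in `r(α)`. -/
def famAt (α : List Alph) : Set (Set V) := {A | A ∈ X.fam ∧ A ⊆ X.range α}

/-! ### The inverse semigroup -/

/-- The condition for `(α, A, β)` to be a nonzero element of the inverse semigroup. -/
def IsTriple (t : List Alph × Set V × List Alph) : Prop :=
  t.1 ∈ X.labelledPaths ∧ t.2.2 ∈ X.labelledPaths ∧
    t.2.1 ∈ X.famAt t.1 ∧ t.2.1 ∈ X.famAt t.2.2 ∧ t.2.1.Nonempty

/-- The inverse semigroup `S` of the labelled space: the triples `(α, A, β)` together with a zero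
element (`none`). -/
def Semi : Type _ := {x : Option (List Alph × Set V × List Alph) // ∀ t ∈ x, X.IsTriple t}

instance : Zero X.Semi := ⟨⟨none, by simp⟩⟩

open Classical in
/-- The product of `S` on underlying triples. -/
noncomputable def rawMul : Option (List Alph × Set V × List Alph) →
    Option (List Alph × Set V × List Alph) → Option (List Alph × Set V × List Alph)
  | some (α, A, β), some (γ, B, δ) =>
    if β <+: γ ∧ (X.relRange A (γ.drop β.length) ∩ B).Nonempty then
      some (α ++ γ.drop β.length, X.relRange A (γ.drop β.length) ∩ B, δ)
    else if γ <+: β ∧ (A ∩ X.relRange B (β.drop γ.length)).Nonempty then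
      some (α, A ∩ X.relRange B (β.drop γ.length), δ ++ β.drop γ.length)
    else none
  | _, _ => none

theorem isTriple_rawMul {x y : Option (List Alph × Set V × List Alph)}
    (hx : ∀ t ∈ x, X.IsTriple t) (hy : ∀ t ∈ y, X.IsTriple t) :
    ∀ t ∈ X.rawMul x y, X.IsTriple t := by
  intro t ht
  rcases x with _ | ⟨α, A, β⟩
  · simp [rawMul] at ht
  rcases y with _ | ⟨γ, B, δ⟩
  · simp [rawMul] at ht
  obtain ⟨hα, hβ, hAα, hAβ, hA⟩ := hx _ rfl
  obtain ⟨hγ, hδ, hBγ, hBδ, hB⟩ := hy _ rfl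
  simp only [rawMul] at ht
  split_ifs at ht with h1 h2
  · cases ht
    have hs : X.relRange A (γ.drop β.length) ⊆ X.range (α ++ γ.drop β.length) :=
      X.relRange_subset_range_append hAα.2
    have hne := h1.2.mono Set.inter_subset_left
    have hm := X.inter_mem _ (X.relRange_mem A hAα.1 _ (X.mem_labelledPaths_of_relRange hne)) _ hBδ.1
    exact ⟨X.mem_labelledPaths_of_relRange (hne.mono hs), hδ,
      ⟨hm, Set.inter_subset_left.trans hs⟩, ⟨hm, Set.inter_subset_right.trans hBδ.2⟩, h1.2⟩
  · cases ht
    have hs : X.relRange B (β.drop γ.length) ⊆ X.range (δ ++ β.drop γ.length) :=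
      X.relRange_subset_range_append hBδ.2
    have hne := h2.2.mono Set.inter_subset_right
    have hm := X.inter_mem _ hAα.1 _ (X.relRange_mem B hBδ.1 _ (X.mem_labelledPaths_of_relRange hne))
    exact ⟨hα, X.mem_labelledPaths_of_relRange (hne.mono hs),
      ⟨hm, Set.inter_subset_left.trans hAα.2⟩, ⟨hm, Set.inter_subset_right.trans hs⟩, h2.2⟩
  · cases ht

noncomputable instance : Mul X.Semi := ⟨fun s t => ⟨X.rawMul s.1 t.1, X.isTriple_rawMul s.2 t.2⟩⟩

/-- The involution `(α, A, β)* = (β, A, α)`. -/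
instance : Star X.Semi :=
  ⟨fun s => ⟨s.1.map fun t => (t.2.2, t.2.1, t.1), by
    intro t ht
    obtain ⟨u, hu, rfl⟩ := Option.mem_map.1 ht
    obtain ⟨h1, h2, h3, h4, h5⟩ := s.2 u hu
    exact ⟨h2, h1, h4, h3, h5⟩⟩⟩

/-- The semilattice of idempotents `E(S)`: the elements `(α, A, α)` and zero. -/
def Idem : Type _ := {s : X.Semi // s.1 = none ∨ ∃ α A, s.1 = some (α, A, α)}

instance : Zero X.Idem := ⟨⟨0, Or.inl rfl⟩⟩

theorem idem_mul (e f : X.Idem) :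
    (e.1 * f.1).1 = none ∨ ∃ α A, (e.1 * f.1).1 = some (α, A, α) := by
  change X.rawMul e.1.1 f.1.1 = none ∨ ∃ α A, X.rawMul e.1.1 f.1.1 = some (α, A, α)
  rcases e.2 with he | ⟨α, A, he⟩
  · left
    rw [he]
    simp [rawMul]
  rcases f.2 with hf | ⟨β, B, hf⟩
  · left
    rw [he, hf]
    simp [rawMul]
  rw [he, hf]
  simp only [rawMul]
  split_ifs with h1 h2
  · right
    obtain ⟨⟨δ, rfl⟩, -⟩ := h1
    exact ⟨α ++ δ, X.relRange A δ ∩ B, by simp⟩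
  · right
    obtain ⟨⟨δ, rfl⟩, -⟩ := h2
    exact ⟨β ++ δ, A ∩ X.relRange B δ, by simp⟩
  · exact Or.inl rfl

noncomputable instance : Mul X.Idem := ⟨fun e f => ⟨e.1 * f.1, X.idem_mul e f⟩⟩

theorem idem_star_mul (s : X.Semi) :
    (star s * s).1 = none ∨ ∃ α A, (star s * s).1 = some (α, A, α) := by
  obtain ⟨_ | ⟨α, A, β⟩, hs⟩ := s
  · left
    rfl
  · right
    refine ⟨β, A, ?_⟩
    change X.rawMul (some (β, A, α)) (some (α, A, β)) = _
    simp [rawMul, X.relRange_nil, (hs _ rfl).2.2.2.2]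

/-- The idempotent `s* s`. -/
noncomputable def starMulSelf (s : X.Semi) : X.Idem := ⟨star s * s, X.idem_star_mul s⟩

/-! ### Words and families of tight filters -/

/-- `w` is the word associated with the filter `ξ`: its nonempty beginnings are the nonempty `β` such
that `(β, A, β) ∈ ξ` for some `A`. -/
def HasWord (ξ : Set X.Idem) (w : LWord Alph) : Prop :=
  ∀ β, w.IsBeginning β ↔ β = [] ∨ ∃ e ∈ ξ, ∃ A, e.1.1 = some (β, A, β)

/-- The family `ξ_n = {A | (w_{1,n}, A, w_{1,n}) ∈ ξ}` of a filter `ξ` with associated word `w`. -/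
def family (w : LWord Alph) (ξ : Set X.Idem) (n : ℕ) : Set (Set V) :=
  {A | ∃ e ∈ ξ, e.1.1 = some (w.take n, A, w.take n)}

/-- The subset `{(w_{1,n}, A, w_{1,n}) | 0 ≤ n ≤ |w|, A ∈ F_n}` of `E(S)` given by a word `w` and a
family `F`. -/
def ofFamily (w : LWord Alph) (F : ℕ → Set (Set V)) : Set X.Idem :=
  {e | ∃ n : ℕ, (n : ℕ∞) ≤ w.length ∧ ∃ A ∈ F n, e.1.1 = some (w.take n, A, w.take n)}

/-! ### Cutting and gluing -/

/-- `h_{[α]β}(F) = {C ∈ 𝓑_β | D ⊆ C for some D ∈ F}`. -/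
def cutAt (β : List Alph) (F : Set (Set V)) : Set (Set V) := {C ∈ X.famAt β | ∃ D ∈ F, D ⊆ C}

open Classical in
/-- The cutting map `H_{[α]γ}` on filters `ξ` with associated word `αγ`. -/
noncomputable def cut (α : List Alph) (γ : LWord Alph) (ξ : Set X.Idem) : Set X.Idem :=
  if α = [] then ξ
  else X.ofFamily γ fun n => X.cutAt (γ.take n) (X.family (γ.append α) ξ (n + α.length))

/-- `g_{(α)β}(F) = {C ∩ r(αβ) | C ∈ F}`, as a function of the word `αβ`. -/
def glueAt (αβ : List Alph) (F : Set (Set V)) : Set (Set V) := {A | ∃ C ∈ F, A = C ∩ X.range αβ}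

/-- `f_{α[β]}(F) = {A ∈ 𝓑_α | r(A, β) ∈ F}`. -/
def dropEnd (α β : List Alph) (F : Set (Set V)) : Set (Set V) :=
  {A ∈ X.famAt α | X.relRange A β ∈ F}

open Classical in
/-- The family of the glued filter `G_{(α)β}(ξ)`, for `α` nonempty. If `β` is empty, then
`η_{|α|}` is glued from `ξ_0`, and if `β` is nonempty, then `η_{|α|+n}` is glued from `ξ_n` for
`n ≥ 1`. The other members are obtained by dropping letters at the end. -/
noncomputable def glueFamily (α : List Alph) (β : LWord Alph) (ξ : Set X.Idem) (i : ℕ) :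
    Set (Set V) :=
  if β = LWord.fin [] then
    if i < α.length then
      X.dropEnd (α.take i) (α.drop i) (X.glueAt α (X.family β ξ 0))
    else X.glueAt α (X.family β ξ 0)
  else
    if i ≤ α.length then
      X.dropEnd (α.take i) (α.drop i ++ β.take 1)
        (X.glueAt (α ++ β.take 1) (X.family β ξ 1))
    else X.glueAt (α ++ β.take (i - α.length)) (X.family β ξ (i - α.length))

open Classical in
/-- The gluing map `G_{(α)β}` on filters `ξ` with associated word `β`. -/
noncomputable def glue (α : List Alph) (β : LWord Alph) (ξ : Set X.Idem) : Set X.Idem :=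
  if α = [] then ξ else X.ofFamily (β.append α) (X.glueFamily α β ξ)

/-! ### The groupoid `Γ` -/

/-- The set `Γ` of triples `(ξ^{αγ}, |α| - |β|, η^{βγ})` with `H_{[α]γ}(ξ) = H_{[β]γ}(η)`. -/
def Gamma : Set (TightFilter X.Idem × ℤ × TightFilter X.Idem) :=
  {t | ∃ (α β : List Alph) (γ : LWord Alph),
    X.HasWord t.1.1 (γ.append α) ∧ X.HasWord t.2.2.1 (γ.append β) ∧
    t.2.1 = (α.length : ℤ) - (β.length : ℤ) ∧ X.cut α γ t.1.1 = X.cut β γ t.2.2.1}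

theorem hasWord_unique {ξ : Set X.Idem} {w w' : LWord Alph} (h : X.HasWord ξ w)
    (h' : X.HasWord ξ w') : w = w' :=
  LWord.eq_of_isBeginning_iff fun β => (h β).trans (h' β).symm

theorem cut_cut (α δ : List Alph) (γ : LWord Alph) (ξ : Set X.Idem) :
    X.cut δ γ (X.cut α (γ.append δ) ξ) = X.cut (α ++ δ) γ ξ := by
  by_cases hα : α = []
  · subst hα
    simp [cut]
  by_cases hδ : δ = []
  · subst hδ
    simp [cut, LWord.append_nil]
  have hαδ : α ++ δ ≠ [] := by simp [hα]
  simp only [cut, hα, hδ, hαδ, if_false]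
  have hfam : ∀ n : ℕ, (n : ℕ∞) ≤ γ.length →
      X.cutAt (γ.take n) (X.family (γ.append δ)
        (X.ofFamily (γ.append δ) fun k => X.cutAt ((γ.append δ).take k)
          (X.family ((γ.append δ).append α) ξ (k + α.length))) (n + δ.length)) =
      X.cutAt (γ.take n) (X.family (γ.append (α ++ δ)) ξ (n + (α ++ δ).length)) := by
    intro n hn
    have hlen : ((n + δ.length : ℕ) : ℕ∞) ≤ (γ.append δ).length := by
      rw [LWord.length_append, add_comm]
      push_cast
      gcongr
    have hidx : n + (α ++ δ).length = n + δ.length + α.length := by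
      rw [List.length_append]
      omega
    rw [LWord.append_append, hidx]
    ext C
    constructor
    · rintro ⟨hC, D, ⟨e, ⟨k, hk, D', hD', he'⟩, he⟩, hDC⟩
      have hkn : k = n + δ.length := by
        rw [he] at he'
        have h1 := congrArg (fun t => (t.map fun u => u.1.length)) he'
        simpa [LWord.length_take hlen, LWord.length_take hk, eq_comm] using h1
      subst hkn
      have hDD : D = D' := by
        rw [he] at he'
        simpa using he'
      subst hDD
      obtain ⟨-, D₁, hD₁, hD₁D⟩ := hD'
      exact ⟨hC, D₁, hD₁, hD₁D.trans hDC⟩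
    · rintro ⟨hC, D, hD, hDC⟩
      refine ⟨hC, D, ?_, hDC⟩
      obtain ⟨e, heξ, he⟩ := hD
      obtain ⟨h1, -, h2, -, h3⟩ := e.1.2 _ he
      simp only at h1 h2 h3
      rw [LWord.take_append] at h1 h2
      have hL := X.mem_labelledPaths_right h1
      have hA : D ∈ X.famAt ((γ.append δ).take (n + δ.length)) :=
        ⟨h2.1, h2.2.trans (X.range_append_subset _ _)⟩
      refine ⟨⟨⟨some (_, D, _), ?_⟩, Or.inr ⟨_, _, rfl⟩⟩, ⟨n + δ.length, hlen, D, ?_, rfl⟩, rfl⟩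
      · intro t ht
        cases ht
        exact ⟨hL, hL, hA, hA, h3⟩
      · exact ⟨hA, D, ⟨e, heξ, he⟩, subset_rfl⟩
  ext e
  constructor
  · rintro ⟨n, hn, A, hA, he⟩
    exact ⟨n, hn, A, (Set.ext_iff.1 (hfam n hn) A).1 hA, he⟩
  · rintro ⟨n, hn, A, hA, he⟩
    exact ⟨n, hn, A, (Set.ext_iff.1 (hfam n hn) A).2 hA, he⟩

theorem inv_mem_gamma {t : TightFilter X.Idem × ℤ × TightFilter X.Idem} (h : t ∈ X.Gamma) :
    (t.2.2, -t.2.1, t.1) ∈ X.Gamma := by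
  obtain ⟨α, β, γ, h1, h2, h3, h4⟩ := h
  exact ⟨β, α, γ, h2, h1, by simp [h3], h4.symm⟩

theorem mul_mem_gamma {ξ η ρ : TightFilter X.Idem} {m n : ℤ} (h : (ξ, m, η) ∈ X.Gamma)
    (h' : (η, n, ρ) ∈ X.Gamma) : (ξ, m + n, ρ) ∈ X.Gamma := by
  obtain ⟨α, β, γ, h1, h2, h3, h4⟩ := h
  obtain ⟨β', δ, γ', k1, k2, k3, k4⟩ := h'
  simp only at h1 h2 h3 h4 k1 k2 k3 k4
  rcases LWord.comparable_of_append_eq _ _ (X.hasWord_unique h2 k1) with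
    ⟨ε, rfl, rfl⟩ | ⟨ε, rfl, rfl⟩
  · refine ⟨α ++ ε, δ, γ', by rwa [LWord.append_append], k2, ?_, ?_⟩
    · simp only [List.length_append] at k3 ⊢
      push_cast at k3 ⊢
      linarith
    · simp only
      rw [← X.cut_cut, h4, X.cut_cut, k4]
  · refine ⟨α, δ ++ ε, γ, h1, by rwa [LWord.append_append], ?_, ?_⟩
    · simp only [List.length_append] at h3 ⊢
      push_cast at h3 ⊢
      linarith
    · simp only
      rw [h4, ← X.cut_cut, k4, X.cut_cut]

/-- The groupoid structure of `Γ`, with product `(ξ, m, η)(η, n, ρ) = (ξ, m + n, ρ)` and inverse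
`(ξ, m, η)⁻¹ = (η, -m, ξ)`. -/
def gammaGroupoid : ArrowGroupoid X.Gamma where
  Comp g h := g.1.2.2 = h.1.1
  mul g h p := ⟨(g.1.1, g.1.2.1 + h.1.2.1, h.1.2.2), by
    obtain ⟨⟨ξ, m, η⟩, hg⟩ := g
    obtain ⟨⟨η', n, ρ⟩, hh⟩ := h
    obtain rfl : η = η' := p
    exact X.mul_mem_gamma hg hh⟩
  inv g := ⟨(g.1.2.2, -g.1.2.1, g.1.1), X.inv_mem_gamma g.2⟩
  inv_inv g := by simp
  mul_assoc g h k p q := ⟨q, p, by simp [add_assoc]⟩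
  inv_comp g := rfl
  comp_inv g := rfl
  inv_mul_cancel g h p := ⟨rfl, by
    apply Subtype.ext
    simp [p]⟩
  mul_inv_cancel h g p := ⟨rfl, by
    apply Subtype.ext
    simp [← p]⟩

/-! ### The tight groupoid `𝒢_tight` and its topology -/

/-- The tight spectrum of `E(S)` as a topological space. -/
abbrev TightCharacter : Type _ := tightSpectrum X.Idem

/-- The tight filter associated with a tight character. -/
def toFilter (φ : X.TightCharacter) : TightFilter X.Idem := ⟨φ.1.filter, φ.1, φ.2, rfl⟩

/-- The set `D_e = {φ | φ(e) = 1}` of tight characters. -/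
def dom (e : X.Idem) : Set X.TightCharacter := {φ | φ.1.1 e = true}

/-- The set `Ω` of pairs `(s, φ)` with `φ ∈ D_{s*s}`. -/
def Omega : Type _ := {p : X.Semi × X.TightCharacter // p.2 ∈ X.dom (X.starMulSelf p.1)}

/-- The relation on `Ω`: `(s, φ) ∼ (t, ψ)` if `φ = ψ` and `se = te` for some idempotent `e` with
`φ ∈ D_e`. -/
def GermRel (p q : X.Omega) : Prop :=
  p.1.2 = q.1.2 ∧ ∃ e : X.Idem, p.1.2 ∈ X.dom e ∧ p.1.1 * e.1 = q.1.1 * e.1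

/-- The set `𝒢_tight` of germs (the relation is an equivalence relation). -/
def TightGroupoid : Type _ := Quot X.GermRel

/-- The germ `[s, φ]`. -/
def germ (s : X.Semi) (φ : X.TightCharacter) (h : φ ∈ X.dom (X.starMulSelf s)) :
    X.TightGroupoid :=
  Quot.mk _ ⟨(s, φ), h⟩

/-- The set `Θ(s, U) = {[s, φ] | φ ∈ U}`. -/
def Theta (s : X.Semi) (U : Set X.TightCharacter) : Set X.TightGroupoid :=
  {g | ∃ φ ∈ U, ∃ h : φ ∈ X.dom (X.starMulSelf s), g = X.germ s φ h}

/-- The topology of `𝒢_tight`, generated by the sets `Θ(s, U)` with `U ⊆ D_{s*s}` open. -/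
abbrev tightTopology : TopologicalSpace X.TightGroupoid :=
  TopologicalSpace.generateFrom
    {W | ∃ (s : X.Semi) (U : Set X.TightCharacter),
      IsOpen U ∧ U ⊆ X.dom (X.starMulSelf s) ∧ W = X.Theta s U}

/-- The topology on `Γ` transported through a bijection `Φ` from `𝒢_tight`. -/
abbrev transportedTopology (Φ : X.TightGroupoid ≃ X.Gamma) : TopologicalSpace X.Gamma :=
  X.tightTopology.coinduced Φ

/-- `Φ` is the map `[t, φ] ↦ ((G_{(β)α'} ∘ H_{[γ]α'})(ξ), |β| - |γ|, ξ)`, where `ξ` is the filter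
associated with `φ`, `t = (β, A, γ)` and `γα'` is the word associated with `ξ`. -/
def IsPhi (Φ : X.TightGroupoid → X.Gamma) : Prop :=
  ∀ (t : X.Semi) (φ : X.TightCharacter) (h : φ ∈ X.dom (X.starMulSelf t))
    (β : List Alph) (A : Set V) (γ : List Alph), t.1 = some (β, A, γ) →
    ∃ α' : LWord Alph, X.HasWord (X.toFilter φ).1 (α'.append γ) ∧
      (Φ (X.germ t φ h)).1.1.1 = X.glue β α' (X.cut γ α' (X.toFilter φ).1) ∧
      (Φ (X.germ t φ h)).1.2.1 = (β.length : ℤ) - (γ.length : ℤ) ∧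
      (Φ (X.germ t φ h)).1.2.2 = X.toFilter φ

/-! ### The sets `Z_{s,e:e_1,…,e_n}` -/

/-- The set `V_{e:e_1,…,e_n}` of tight filters that contain `e` and none of `e_1, …, e_n`. -/
def basicSet (e : X.Idem) (T : Finset X.Idem) : Set (TightFilter X.Idem) :=
  {ξ | e ∈ ξ.1 ∧ ∀ f ∈ T, f ∉ ξ.1}

/-- The set `Z_{s,e:e_1,…,e_n}`, where `T = {e_1, …, e_n}`, of the triples
`(η^{μγ}, |μ| - |ν|, ξ^{νγ})` with `ξ ∈ V_{e:e_1,…,e_n}` and `H_{[μ]γ}(η) = H_{[ν]γ}(ξ)`, where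
`s = (μ, A, ν)`. -/
def Z (s : X.Semi) (e : X.Idem) (T : Finset X.Idem) : Set X.Gamma :=
  {t | ∃ (μ : List Alph) (A : Set V) (ν : List Alph) (γ : LWord Alph), s.1 = some (μ, A, ν) ∧
    X.HasWord t.1.1.1 (γ.append μ) ∧ X.HasWord t.1.2.2.1 (γ.append ν) ∧
    t.1.2.1 = (μ.length : ℤ) - (ν.length : ℤ) ∧
    t.1.2.2 ∈ X.basicSet e T ∧ X.cut μ γ t.1.1.1 = X.cut ν γ t.1.2.2.1}

end LabelledSpace

/-! ## Relative ranges -/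

namespace LabelledGraph

variable {V Edge Alph : Type*} (X : LabelledGraph V Edge Alph)

/-! An element `(α, A, β)` acts on pairs of a word and a vertex as the partial bijection taking
`(βδ, v)` to `(αδ, v)`, defined where `v ∈ r(A, δ)`. Because the space is weakly left-resolving, the
product of the inverse semigroup is composition of these maps (`rel_mul`), and the representation is
faithful (`rel_ext`). Idempotents become sets of points, their product becomes intersection, and
every identity needed in the semigroup can be checked on points.

Conjugation `e ↦ s* e s` makes `s` act on the characters `φ` with `φ(s* s) = 1`. The action
preserves ultrafilters and is continuous on an open domain, so it preserves their closure, the tight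
spectrum (`act_mem_tightSpectrum`). On families, `(β, A, γ)` exchanges the beginning `γ` for `β` and
leaves the cut filter unchanged (`cut_act`), while gluing undoes cutting for every filter
(`glue_cut`). Hence the action is `G ∘ H`, and `[s, φ] ↦ (sφ, |β| - |γ|, φ)` lands in `Γ`; this map
is `chart`.

Injectivity: if two germs at `φ` have the same image, their words are comparable and the degrees
force the longer triple to be `(βδ, B, γδ)`, which agrees with `(β, A, γ)` wherever both are
defined. Surjectivity: equality of the two cuts forces `r(μ) ∩ r(ν)` into the source filter at `ν`,
so `(μ, r(μ) ∩ r(ν), ν)` is applicable there, and its value is the range filter because a filter is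
recovered from its word and its cut. If `μ` and `ν` are both empty, the element is a unit and any
idempotent in the filter serves instead.

Two charts that meet at a point agree on a neighbourhood of the form `D_e`. So the charts are
continuous, their images form a basis, and in charts the inverse is `s ↦ s*` and the product is `(s,
t) ↦ st`. Each set `Z` is the image under a single chart of a compact open set of characters
(`exists_Z_eq_chartSet`), from which compactness, openness and the bisection property follow. -/

theorem relRange_append (A : Set V) (α β : List Alph) :
    X.relRange A (α ++ β) = X.relRange (X.relRange A α) β := by
  by_cases hα : α = []
  · subst hα
    rw [X.relRange_nil, List.nil_append]
  by_cases hβ : β = []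
  · subst hβ
    rw [X.relRange_nil, List.append_nil]
  ext v
  constructor
  · rintro (⟨h, -⟩ | ⟨l, hl, hp, hm, hs, hr⟩)
    · exact absurd (List.append_eq_nil_iff.1 h).1 hα
    obtain ⟨l₁, l₂, rfl, h₁, h₂⟩ := List.map_eq_append_iff.1 hm
    have h1 : l₁ ≠ [] := by
      rintro rfl
      exact hα h₁.symm
    have h2 : l₂ ≠ [] := by
      rintro rfl
      exact hβ h₂.symm
    obtain ⟨hp1, hp2, hp3⟩ := List.isChain_append.1 hp
    rw [List.getLast_append_of_ne_nil _ h2] at hr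
    rw [List.head_append_of_ne_nil h1] at hs
    refine Or.inr ⟨l₂, h2, hp2, h₂, Or.inr ⟨l₁, h1, hp1, h₁, hs, ?_⟩, hr⟩
    exact hp3 _ (List.getLast?_eq_some_getLast h1) _ (List.head?_eq_some_head h2)
  · rintro (⟨h, -⟩ | ⟨l, hl, hp, hm, hs, hr⟩)
    · exact absurd h hβ
    rcases hs with ⟨h, -⟩ | ⟨l', hl', hp', hm', hs', hr'⟩
    · exact absurd h hα
    refine Or.inr ⟨l' ++ l, by simp [hl], ?_, by simp [hm, hm'], ?_, ?_⟩
    · refine List.IsChain.append hp' hp ?_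
      intro x hx y hy
      rw [List.getLast?_eq_some_getLast hl'] at hx
      rw [List.head?_eq_some_head hl] at hy
      cases hx
      cases hy
      exact hr'
    · rw [List.head_append_of_ne_nil hl']
      exact hs'
    · rw [List.getLast_append_of_ne_nil _ hl]
      exact hr

theorem relRange_mono {A B : Set V} (h : A ⊆ B) (α : List Alph) :
    X.relRange A α ⊆ X.relRange B α := by
  rintro v (⟨rfl, hv⟩ | ⟨l, hl, hp, hm, hs, hr⟩)
  · exact Or.inl ⟨rfl, h hv⟩
  · exact Or.inr ⟨l, hl, hp, hm, h hs, hr⟩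

theorem nonempty_of_relRange {A : Set V} {α : List Alph} (h : (X.relRange A α).Nonempty) :
    A.Nonempty := by
  obtain ⟨v, ⟨-, hv⟩ | ⟨l, hl, -, -, hs, -⟩⟩ := h
  · exact ⟨v, hv⟩
  · exact ⟨_, hs⟩

theorem range_append (α β : List Alph) : X.range (α ++ β) = X.relRange (X.range α) β :=
  X.relRange_append _ _ _

theorem range_nil : X.range [] = Set.univ := X.relRange_nil _

end LabelledGraph

namespace LabelledSpace

variable {V Edge Alph : Type*} {X : LabelledSpace V Edge Alph}

/-- The restrictions on the word are harmless: the empty word acts as the identity, and a word that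
labels no path has empty relative ranges. -/
theorem WeaklyLeftResolving.relRange_inter (hw : X.WeaklyLeftResolving) {A B : Set V}
    (hA : A ∈ X.fam) (hB : B ∈ X.fam) (α : List Alph) :
    X.relRange (A ∩ B) α = X.relRange A α ∩ X.relRange B α := by
  by_cases h0 : α = []
  · subst h0
    simp only [X.relRange_nil]
  by_cases h1 : α ∈ X.labelledPaths
  · exact hw A hA B hB α h1 h0
  have key : ∀ C : Set V, X.relRange C α = ∅ := fun C =>
    Set.not_nonempty_iff_eq_empty.1 fun h => h1 (X.mem_labelledPaths_of_relRange h)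
  simp [key]

variable (X)

theorem relRange_mem_of_nonempty {A : Set V} (hA : A ∈ X.fam) {α : List Alph}
    (h : (X.relRange A α).Nonempty) : X.relRange A α ∈ X.fam :=
  X.relRange_mem A hA α (X.mem_labelledPaths_of_relRange h)

/-! ## The representation of the inverse semigroup by relations -/

/-- The relation on pairs of a word and a vertex that represents an element `(α, A, β)` of the
inverse semigroup: `(αδ, v)` is related to `(βδ, v)` whenever `v ∈ r(A, δ)`. -/
def rawRel (x : Option (List Alph × Set V × List Alph)) (p q : List Alph × V) : Prop :=
  ∃ t ∈ x, ∃ δ, p.1 = t.1 ++ δ ∧ q.1 = t.2.2 ++ δ ∧ p.2 = q.2 ∧ p.2 ∈ X.relRange t.2.1 δ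

theorem rawRel_some (α : List Alph) (A : Set V) (β : List Alph) (p q : List Alph × V) :
    X.rawRel (some (α, A, β)) p q ↔
      ∃ δ, p.1 = α ++ δ ∧ q.1 = β ++ δ ∧ p.2 = q.2 ∧ p.2 ∈ X.relRange A δ := by
  simp [rawRel]

/-- The relation on pairs of a word and a vertex that represents an element of the inverse
semigroup. -/
def Rel (s : X.Semi) (p q : List Alph × V) : Prop := X.rawRel s.1 p q

theorem Rel.of_eq {s : X.Semi} {α β : List Alph} {A : Set V} (hs : s.1 = some (α, A, β))
    {p q : List Alph × V} :
    X.Rel s p q ↔ ∃ δ, p.1 = α ++ δ ∧ q.1 = β ++ δ ∧ p.2 = q.2 ∧ p.2 ∈ X.relRange A δ := by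
  rw [Rel, hs, rawRel_some]

theorem not_rel_zero (p q : List Alph × V) : ¬ X.Rel 0 p q := by
  rintro ⟨t, ht, -⟩
  cases ht

theorem rel_star (s : X.Semi) (p q : List Alph × V) : X.Rel (star s) p q ↔ X.Rel s q p := by
  obtain ⟨_ | ⟨α, A, β⟩, hs⟩ := s
  · constructor
    · rintro ⟨t, ht, -⟩
      cases ht
    · rintro ⟨t, ht, -⟩
      cases ht
  · change X.rawRel (some (β, A, α)) p q ↔ X.rawRel (some (α, A, β)) q p
    simp only [rawRel_some]
    constructor
    · rintro ⟨δ, h1, h2, h3, h4⟩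
      exact ⟨δ, h2, h1, h3.symm, h3 ▸ h4⟩
    · rintro ⟨δ, h1, h2, h3, h4⟩
      exact ⟨δ, h2, h1, h3.symm, h3 ▸ h4⟩

theorem Rel.left_unique {s : X.Semi} {p p' q : List Alph × V} (h : X.Rel s p q)
    (h' : X.Rel s p' q) : p = p' := by
  obtain ⟨t, ht, δ, h1, h2, h3, -⟩ := h
  obtain ⟨t', ht', δ', h1', h2', h3', -⟩ := h'
  obtain rfl : t = t' := by
    rw [ht] at ht'
    simpa using ht'
  obtain rfl : δ = δ' := List.append_cancel_left (h2.symm.trans h2')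
  exact Prod.ext (h1.trans h1'.symm) (h3.trans h3'.symm)

/-- The word of an intermediate point begins with both inner words `β` and `γ`, so one of these
extends the other, matching the two cases of the product. Compatibility of relative ranges with
intersections merges the two vertex conditions into one, and the vertex itself shows that the middle
set of the product is non-empty. -/
theorem rel_mul (hw : X.WeaklyLeftResolving) (s t : X.Semi) (p q : List Alph × V) :
    X.Rel (s * t) p q ↔ ∃ m, X.Rel s p m ∧ X.Rel t m q := by
  obtain ⟨_ | ⟨α, A, β⟩, hs⟩ := s
  · constructor
    · rintro ⟨u, hu, -⟩
      change u ∈ X.rawMul none t.1 at hu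
      simp [rawMul] at hu
    · rintro ⟨m, ⟨u, hu, -⟩, -⟩
      cases hu
  obtain ⟨_ | ⟨γ, B, δ⟩, ht⟩ := t
  · constructor
    · rintro ⟨u, hu, -⟩
      change u ∈ X.rawMul (some (α, A, β)) none at hu
      simp [rawMul] at hu
    · rintro ⟨m, -, ⟨u, hu, -⟩⟩
      cases hu
  obtain ⟨-, -, hA, -, -⟩ := hs _ rfl
  obtain ⟨-, -, hB, -, -⟩ := ht _ rfl
  change X.rawRel (X.rawMul (some (α, A, β)) (some (γ, B, δ))) p q ↔
    ∃ m, X.rawRel (some (α, A, β)) p m ∧ X.rawRel (some (γ, B, δ)) m q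
  simp only [rawRel_some]
  obtain ⟨x, v⟩ := p
  obtain ⟨y, v'⟩ := q
  constructor
  · rintro ⟨u, hu, ε, h1, h2, h3, h4⟩
    simp only at h1 h2 h3 h4
    subst h1 h2 h3
    simp only [rawMul] at hu
    split_ifs at hu with c1 c2
    · cases hu
      obtain ⟨⟨ζ, rfl⟩, hne⟩ := c1
      simp only [List.drop_left] at h4 hne ⊢
      rw [hw.relRange_inter (X.relRange_mem_of_nonempty hA.1 (hne.mono Set.inter_subset_left))
        hB.1] at h4
      refine ⟨(β ++ ζ ++ ε, v), ⟨ζ ++ ε, ?_, ?_, rfl, ?_⟩, ε, rfl, rfl, rfl, h4.2⟩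
      · simp
      · simp
      · rw [X.relRange_append]
        exact h4.1
    · cases hu
      obtain ⟨⟨ζ, rfl⟩, hne⟩ := c2
      simp only [List.drop_left] at h4 hne ⊢
      rw [hw.relRange_inter hA.1
        (X.relRange_mem_of_nonempty hB.1 (hne.mono Set.inter_subset_right))] at h4
      refine ⟨(γ ++ ζ ++ ε, v), ⟨ε, rfl, rfl, rfl, h4.1⟩, ζ ++ ε, ?_, ?_, rfl, ?_⟩
      · simp
      · simp
      · rw [X.relRange_append]
        exact h4.2
    · cases hu
  · rintro ⟨⟨z, w⟩, ⟨ζ, h1, h2, h3, h4⟩, ε, h5, h6, h7, h8⟩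
    simp only at h1 h2 h3 h4 h5 h6 h7 h8
    subst h1 h2 h3 h6 h7
    -- This case includes `γ = β`, since `rawMul` tests `β <+: γ` before the other alternative.
    have first : ∀ a, γ = β ++ a → ζ = a ++ ε →
        X.rawRel (X.rawMul (some (α, A, β)) (some (γ, B, δ))) (α ++ ζ, v) (δ ++ ε, v) := by
      rintro a rfl rfl
      rw [X.relRange_append] at h4
      have hm := X.relRange_mem_of_nonempty hA.1 (X.nonempty_of_relRange ⟨v, h4⟩)
      have h9 : v ∈ X.relRange (X.relRange A a ∩ B) ε := by
        rw [hw.relRange_inter hm hB.1]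
        exact ⟨h4, h8⟩
      have hne := X.nonempty_of_relRange ⟨v, h9⟩
      refine ⟨(α ++ a, X.relRange A a ∩ B, δ), ?_, ε, ?_, rfl, rfl, h9⟩
      · simp [rawMul, hne]
      · simp
    rcases List.append_eq_append_iff.1 h5 with ⟨a, ha, hb⟩ | ⟨a, ha, hb⟩
    · exact first a ha hb
    by_cases ha0 : a = []
    · subst ha0
      exact first [] (by simpa using ha.symm) (by simpa using hb.symm)
    subst ha hb
    rw [X.relRange_append] at h8
    have hm := X.relRange_mem_of_nonempty hB.1 (X.nonempty_of_relRange ⟨v, h8⟩)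
    have h9 : v ∈ X.relRange (A ∩ X.relRange B a) ζ := by
      rw [hw.relRange_inter hA.1 hm]
      exact ⟨h4, h8⟩
    have hne := X.nonempty_of_relRange ⟨v, h9⟩
    refine ⟨(α, A ∩ X.relRange B a, δ ++ a), ?_, ζ, rfl, ?_, rfl, h9⟩
    · have hnp : ¬ (γ ++ a <+: γ) := fun h => by
        have := h.length_le
        simp only [List.length_append] at this
        exact ha0 (List.length_eq_zero_iff.1 (by omega))
      simp [rawMul, hnp, hne]
    · simp

variable {X}

/-- A triple can be read off from its related pairs with shortest words: these words are its outer
entries, and the vertices occurring there form its middle set. -/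
theorem rel_ext {s t : X.Semi} (h : ∀ p q, X.Rel s p q ↔ X.Rel t p q) : s = t := by
  obtain ⟨_ | ⟨α, A, β⟩, hs⟩ := s
  · obtain ⟨_ | ⟨γ, B, δ⟩, ht⟩ := t
    · rfl
    · obtain ⟨-, -, -, -, v, hv⟩ := ht _ rfl
      have := (h (γ, v) (δ, v)).2
        ((X.rawRel_some _ _ _ _ _).2 ⟨[], by simp, by simp, rfl, by rwa [X.relRange_nil]⟩)
      exact absurd this (X.not_rel_zero _ _)
  · obtain ⟨-, -, -, -, v, hv⟩ := hs _ rfl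
    have hl : ∀ v ∈ A, X.Rel ⟨some (α, A, β), hs⟩ (α, v) (β, v) := fun v hv =>
      (X.rawRel_some _ _ _ _ _).2 ⟨[], by simp, by simp, rfl, by rwa [X.relRange_nil]⟩
    obtain ⟨_ | ⟨γ, B, δ⟩, ht⟩ := t
    · exact absurd ((h _ _).1 (hl v hv)) (X.not_rel_zero _ _)
    · obtain ⟨-, -, -, -, w, hwB⟩ := ht _ rfl
      have hr : ∀ v ∈ B, X.Rel ⟨some (γ, B, δ), ht⟩ (γ, v) (δ, v) := fun v hv =>
        (X.rawRel_some _ _ _ _ _).2 ⟨[], by simp, by simp, rfl, by rwa [X.relRange_nil]⟩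
      have k1 : ∀ v ∈ A, ∃ ε, α = γ ++ ε ∧ β = δ ++ ε ∧ v ∈ X.relRange B ε := fun v hv => by
        obtain ⟨ε, h1, h2, -, h3⟩ := (X.rawRel_some _ _ _ _ _).1 ((h _ _).1 (hl v hv))
        exact ⟨ε, h1, h2, h3⟩
      have k2 : ∀ v ∈ B, ∃ ε, γ = α ++ ε ∧ δ = β ++ ε ∧ v ∈ X.relRange A ε := fun v hv => by
        obtain ⟨ε, h1, h2, -, h3⟩ := (X.rawRel_some _ _ _ _ _).1 ((h _ _).2 (hr v hv))
        exact ⟨ε, h1, h2, h3⟩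
      obtain ⟨ε, h1, h2, h3⟩ := k1 v hv
      obtain ⟨ε', h1', h2', h3'⟩ := k2 w hwB
      -- Each first word extends the other, so both remainders are empty.
      have hε : ε = [] := by
        have a1 := congrArg List.length h1
        have a2 := congrArg List.length h1'
        simp only [List.length_append] at a1 a2
        exact List.length_eq_zero_iff.1 (by omega)
      subst hε
      simp only [List.append_nil] at h1 h2
      subst h1 h2
      have : A = B := by
        ext u
        constructor
        · intro hu
          obtain ⟨ε, h1, -, h3⟩ := k1 u hu
          obtain rfl : ε = [] := by simpa using h1
          rwa [X.relRange_nil] at h3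
        · intro hu
          obtain ⟨ε, h1, -, h3⟩ := k2 u hu
          obtain rfl : ε = [] := by simpa using h1
          rwa [X.relRange_nil] at h3
      subst this
      rfl

theorem Rel.right_unique {s : X.Semi} {p q q' : List Alph × V} (h : X.Rel s p q)
    (h' : X.Rel s p q') : q = q' :=
  Rel.left_unique X ((X.rel_star s _ _).2 h) ((X.rel_star s _ _).2 h')

theorem Rel.of_idem {e : X.Idem} {p q : List Alph × V} (h : X.Rel e.1 p q) : p = q := by
  obtain ⟨t, ht, δ, h1, h2, h3, -⟩ := h
  rcases e.2 with he | ⟨α, A, he⟩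
  · rw [he] at ht
    cases ht
  · rw [he] at ht
    cases ht
    exact Prod.ext (h1.trans h2.symm) h3

variable (X)

/-! ## The semilattice of idempotents as a family of sets -/

/-- The set of pairs of a word and a vertex that represents an idempotent. -/
def supp (e : X.Idem) : Set (List Alph × V) := {p | X.Rel e.1 p p}

theorem mem_supp_of_eq {e : X.Idem} {α : List Alph} {A : Set V} (he : e.1.1 = some (α, A, α))
    {p : List Alph × V} : p ∈ X.supp e ↔ ∃ δ, p.1 = α ++ δ ∧ p.2 ∈ X.relRange A δ := by
  simp [supp, Rel.of_eq X he]

variable {X}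

theorem rel_idem (e : X.Idem) (p q : List Alph × V) : X.Rel e.1 p q ↔ p = q ∧ p ∈ X.supp e := by
  constructor
  · intro h
    obtain rfl := Rel.of_idem h
    exact ⟨rfl, h⟩
  · rintro ⟨rfl, h⟩
    exact h

theorem supp_ext {e f : X.Idem} (h : X.supp e = X.supp f) : e = f :=
  Subtype.ext (rel_ext fun p q => by rw [rel_idem, rel_idem, h])

theorem supp_zero : X.supp 0 = ∅ := Set.eq_empty_iff_forall_notMem.2 fun p => X.not_rel_zero p p

theorem supp_mul (hw : X.WeaklyLeftResolving) (e f : X.Idem) :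
    X.supp (e * f) = X.supp e ∩ X.supp f := by
  ext p
  change X.Rel (e.1 * f.1) p p ↔ _
  rw [rel_mul X hw]
  constructor
  · rintro ⟨m, h1, h2⟩
    obtain rfl := Rel.of_idem h1
    exact ⟨h1, h2⟩
  · rintro ⟨h1, h2⟩
    exact ⟨p, h1, h2⟩

theorem mul_eq_left_iff (hw : X.WeaklyLeftResolving) {e f : X.Idem} :
    e * f = e ↔ X.supp e ⊆ X.supp f := by
  rw [← Set.inter_eq_left, ← supp_mul hw]
  exact ⟨fun h => by rw [h], supp_ext⟩

theorem mem_supp_starMulSelf (hw : X.WeaklyLeftResolving) {s : X.Semi} {p : List Alph × V} :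
    p ∈ X.supp (X.starMulSelf s) ↔ ∃ q, X.Rel s q p := by
  change X.Rel (star s * s) p p ↔ _
  rw [rel_mul X hw]
  simp only [rel_star, and_self]

theorem rel_mul_idem (hw : X.WeaklyLeftResolving) {s : X.Semi} {e : X.Idem}
    {p q : List Alph × V} : X.Rel (s * e.1) p q ↔ X.Rel s p q ∧ q ∈ X.supp e := by
  rw [rel_mul X hw]
  simp only [rel_idem]
  constructor
  · rintro ⟨m, h1, rfl, h2⟩
    exact ⟨h1, h2⟩
  · rintro ⟨h1, h2⟩
    exact ⟨q, h1, rfl, h2⟩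

theorem rel_idem_mul (hw : X.WeaklyLeftResolving) {s : X.Semi} {e : X.Idem}
    {p q : List Alph × V} : X.Rel (e.1 * s) p q ↔ p ∈ X.supp e ∧ X.Rel s p q := by
  rw [rel_mul X hw]
  simp only [rel_idem]
  constructor
  · rintro ⟨m, ⟨rfl, h1⟩, h2⟩
    exact ⟨h1, h2⟩
  · rintro ⟨h1, h2⟩
    exact ⟨p, ⟨rfl, h1⟩, h2⟩

theorem starMulSelf_idem (hw : X.WeaklyLeftResolving) (e : X.Idem) : X.starMulSelf e.1 = e := by
  refine supp_ext (Set.ext fun p => ?_)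
  rw [mem_supp_starMulSelf hw]
  constructor
  · rintro ⟨q, h⟩
    obtain rfl := Rel.of_idem h
    exact h
  · exact fun h => ⟨p, h⟩

theorem star_star_semi (s : X.Semi) : star (star s) = s :=
  rel_ext fun p q => by rw [rel_star, rel_star]

/-! ## Explicit elements -/

theorem isTriple_of_subset {α β : List Alph} {A : Set V} (hA : A ∈ X.fam) (h1 : A ⊆ X.range α)
    (h2 : A ⊆ X.range β) (hne : A.Nonempty) : X.IsTriple (α, A, β) :=
  ⟨X.mem_labelledPaths_of_relRange (hne.mono h1), X.mem_labelledPaths_of_relRange (hne.mono h2),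
    ⟨hA, h1⟩, ⟨hA, h2⟩, hne⟩

variable (X) in
/-- The element `(α, A, β)` of the inverse semigroup. -/
def triple (α : List Alph) (A : Set V) (β : List Alph) (h : X.IsTriple (α, A, β)) : X.Semi :=
  ⟨some (α, A, β), by
    intro t ht
    cases ht
    exact h⟩

variable (X) in
/-- The idempotent `(α, A, α)`. -/
def idem (α : List Alph) (A : Set V) (h : X.IsTriple (α, A, α)) : X.Idem :=
  ⟨X.triple α A α h, Or.inr ⟨α, A, rfl⟩⟩

theorem idem_eq_zero_or (e : X.Idem) : e = 0 ∨ ∃ α A, e.1.1 = some (α, A, α) := by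
  rcases e.2 with h | h
  · exact Or.inl (Subtype.ext (Subtype.ext h))
  · exact Or.inr h

theorem semi_ne_zero_iff {s : X.Semi} : s ≠ 0 ↔ ∃ α A β, s.1 = some (α, A, β) := by
  obtain ⟨_ | ⟨α, A, β⟩, hs⟩ := s
  · refine ⟨fun h => absurd rfl h, ?_⟩
    rintro ⟨_, _, _, h⟩
    cases h
  · exact ⟨fun _ => ⟨α, A, β, rfl⟩, fun _ h => by
      have := congrArg Subtype.val h
      cases this⟩

theorem starMulSelf_eq {s : X.Semi} {α β : List Alph} {A : Set V} (hs : s.1 = some (α, A, β)) :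
    (X.starMulSelf s).1.1 = some (β, A, β) := by
  obtain ⟨x, hx⟩ := s
  simp only at hs
  subst hs
  change X.rawMul (some (β, A, α)) (some (α, A, β)) = _
  simp [rawMul, X.relRange_nil, (hx _ rfl).2.2.2.2]

theorem star_eq {s : X.Semi} {α β : List Alph} {A : Set V} (hs : s.1 = some (α, A, β)) :
    (star s : X.Semi).1 = some (β, A, α) := by
  obtain ⟨x, hx⟩ := s
  simp only at hs
  subst hs
  rfl

end LabelledSpace

namespace LabelledSpace

variable {V Edge Alph : Type*} {X : LabelledSpace V Edge Alph}

/-! ## Conjugation of idempotents -/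

variable (X) in
/-- The idempotent `s* e s`. -/
noncomputable def conj (s : X.Semi) (e : X.Idem) : X.Idem := X.starMulSelf (e.1 * s)

theorem mem_supp_conj (hw : X.WeaklyLeftResolving) {s : X.Semi} {e : X.Idem}
    {p : List Alph × V} : p ∈ X.supp (X.conj s e) ↔ ∃ q ∈ X.supp e, X.Rel s q p := by
  simp only [conj, mem_supp_starMulSelf hw, rel_idem_mul hw]

theorem conj_zero (hw : X.WeaklyLeftResolving) (s : X.Semi) : X.conj s 0 = 0 := by
  refine supp_ext (Set.ext fun p => ?_)
  rw [mem_supp_conj hw, supp_zero]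
  simp

theorem conj_mul (hw : X.WeaklyLeftResolving) (s : X.Semi) (e f : X.Idem) :
    X.conj s (e * f) = X.conj s e * X.conj s f := by
  refine supp_ext (Set.ext fun p => ?_)
  rw [supp_mul hw, Set.mem_inter_iff, mem_supp_conj hw, mem_supp_conj hw, mem_supp_conj hw,
    supp_mul hw]
  constructor
  · rintro ⟨q, ⟨h1, h2⟩, h3⟩
    exact ⟨⟨q, h1, h3⟩, q, h2, h3⟩
  · rintro ⟨⟨q, h1, h3⟩, q', h2, h3'⟩
    obtain rfl := Rel.left_unique X h3 h3'
    exact ⟨q, ⟨h1, h2⟩, h3⟩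

theorem conj_semi_mul (hw : X.WeaklyLeftResolving) (s t : X.Semi) (e : X.Idem) :
    X.conj (s * t) e = X.conj t (X.conj s e) := by
  refine supp_ext (Set.ext fun p => ?_)
  simp only [mem_supp_conj hw, rel_mul X hw]
  constructor
  · rintro ⟨q, h1, m, h2, h3⟩
    exact ⟨m, ⟨q, h1, h2⟩, h3⟩
  · rintro ⟨m, ⟨q, h1, h2⟩, h3⟩
    exact ⟨q, h1, m, h2, h3⟩

theorem starMulSelf_mul (hw : X.WeaklyLeftResolving) (s t : X.Semi) :
    X.starMulSelf (s * t) = X.conj t (X.starMulSelf s) := by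
  refine supp_ext (Set.ext fun p => ?_)
  simp only [mem_supp_conj hw, mem_supp_starMulSelf hw, rel_mul X hw]
  constructor
  · rintro ⟨q, m, h2, h3⟩
    exact ⟨m, ⟨q, h2⟩, h3⟩
  · rintro ⟨m, ⟨q, h2⟩, h3⟩
    exact ⟨q, m, h2, h3⟩

theorem conj_idem (hw : X.WeaklyLeftResolving) (e f : X.Idem) : X.conj e.1 f = f * e := by
  refine supp_ext (Set.ext fun p => ?_)
  rw [mem_supp_conj hw, supp_mul hw]
  simp only [rel_idem]
  constructor
  · rintro ⟨q, h1, rfl, h2⟩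
    exact ⟨h1, h2⟩
  · rintro ⟨h1, h2⟩
    exact ⟨p, h1, rfl, h2⟩

/-- Since `s` is a partial bijection, going along `s` and back returns to the same point; all that
remains of the conjugation is the restriction to the domain of `s`. -/
theorem conj_star_conj (hw : X.WeaklyLeftResolving) (s : X.Semi) (e : X.Idem) :
    X.conj s (X.conj (star s) e) = e * X.starMulSelf s := by
  refine supp_ext (Set.ext fun p => ?_)
  rw [mem_supp_conj hw, supp_mul hw, Set.mem_inter_iff, mem_supp_starMulSelf hw]
  simp only [mem_supp_conj hw, rel_star]
  constructor
  · rintro ⟨q, ⟨m, h1, h2⟩, h3⟩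
    obtain rfl := Rel.right_unique h2 h3
    exact ⟨h1, q, h3⟩
  · rintro ⟨h1, q, h2⟩
    exact ⟨q, ⟨p, h1, h2⟩, h2⟩

theorem conj_starMulSelf_star (hw : X.WeaklyLeftResolving) (s : X.Semi) :
    X.conj s (X.starMulSelf (star s)) = X.starMulSelf s := by
  refine supp_ext (Set.ext fun p => ?_)
  simp only [mem_supp_conj hw, mem_supp_starMulSelf hw, rel_star]
  exact ⟨fun ⟨q, _, h⟩ => ⟨q, h⟩, fun ⟨q, h⟩ => ⟨q, ⟨p, h⟩, h⟩⟩

/-- Multiplying by `e` is conjugating by `e`, so each side is conjugation by `se = te`. This makes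
the action depend only on the germ. -/
theorem conj_mul_eq_of_mul_eq (hw : X.WeaklyLeftResolving) {s t : X.Semi} {e : X.Idem}
    (h : s * e.1 = t * e.1) (f : X.Idem) : X.conj s f * e = X.conj t f * e := by
  rw [← conj_idem hw, ← conj_idem hw, ← conj_semi_mul hw, ← conj_semi_mul hw, h]

/-! ## Filters and characters -/

theorem filter_mono (hw : X.WeaklyLeftResolving) {ξ : Set X.Idem} (hξ : IsSemilatticeFilter ξ)
    {e f : X.Idem} (he : e ∈ ξ) (h : X.supp e ⊆ X.supp f) : f ∈ ξ :=
  hξ.upper e he f ((mul_eq_left_iff hw).2 h)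

theorem isSemilatticeFilter_filter (φ : CharacterSpace X.Idem) :
    IsSemilatticeFilter φ.filter where
  nonempty := φ.2.nonzero
  zero_notMem h := by
    have h1 : φ.1 0 = true := h
    rw [φ.2.map_zero] at h1
    cases h1
  mul_mem e he f hf := by
    have h1 : φ.1 e = true := he
    have h2 : φ.1 f = true := hf
    change φ.1 (e * f) = true
    rw [φ.2.map_mul, h1, h2]
    rfl
  upper e he f h := by
    have h1 : φ.1 e = true := he
    rw [← h, φ.2.map_mul, Bool.and_eq_true] at h1
    exact h1.2

theorem filter_injective {φ ψ : CharacterSpace X.Idem} (h : φ.filter = ψ.filter) : φ = ψ :=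
  Subtype.ext (funext fun e => Bool.eq_iff_iff.2 (Set.ext_iff.1 h e))

open Classical in
theorem exists_filter_eq (hw : X.WeaklyLeftResolving) {ξ : Set X.Idem}
    (hξ : IsSemilatticeFilter ξ) : ∃ φ : CharacterSpace X.Idem, φ.filter = ξ := by
  refine ⟨⟨fun e => decide (e ∈ ξ), ?_, ?_, ?_⟩, ?_⟩
  · simpa using hξ.zero_notMem
  · intro e f
    rw [Bool.eq_iff_iff, Bool.and_eq_true]
    simp only [decide_eq_true_eq]
    refine ⟨fun h => ⟨filter_mono hw hξ h ?_, filter_mono hw hξ h ?_⟩,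
      fun h => hξ.mul_mem _ h.1 _ h.2⟩
    · rw [supp_mul hw]
      exact Set.inter_subset_left
    · rw [supp_mul hw]
      exact Set.inter_subset_right
  · obtain ⟨e, he⟩ := hξ.nonempty
    exact ⟨e, by simpa using he⟩
  · ext e
    simp [CharacterSpace.filter]

theorem character_mono (hw : X.WeaklyLeftResolving) (φ : CharacterSpace X.Idem) {e f : X.Idem}
    (he : φ.1 e = true) (h : X.supp e ⊆ X.supp f) : φ.1 f = true :=
  filter_mono hw (isSemilatticeFilter_filter φ) he h

theorem character_mul_iff (φ : CharacterSpace X.Idem) {e f : X.Idem} :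
    φ.1 (e * f) = true ↔ φ.1 e = true ∧ φ.1 f = true := by
  rw [φ.2.map_mul, Bool.and_eq_true]

/-! ## The action of the inverse semigroup on characters -/

/-- The action `φ ↦ (e ↦ φ(s* e s))` of `s` on the characters with `φ(s* s) = 1`. -/
noncomputable def act (hw : X.WeaklyLeftResolving) (s : X.Semi) (φ : CharacterSpace X.Idem)
    (h : φ.1 (X.starMulSelf s) = true) : CharacterSpace X.Idem :=
  ⟨fun e => φ.1 (X.conj s e), by
    constructor
    · rw [conj_zero hw, φ.2.map_zero]
    · intro e f
      rw [conj_mul hw, φ.2.map_mul]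
    · exact ⟨X.starMulSelf (star s), by rw [conj_starMulSelf_star hw, h]⟩⟩

theorem act_apply (hw : X.WeaklyLeftResolving) (s : X.Semi) (φ : CharacterSpace X.Idem)
    (h : φ.1 (X.starMulSelf s) = true) (e : X.Idem) :
    (act hw s φ h).1 e = φ.1 (X.conj s e) := rfl

theorem act_starMulSelf_star (hw : X.WeaklyLeftResolving) (s : X.Semi) (φ : CharacterSpace X.Idem)
    (h : φ.1 (X.starMulSelf s) = true) :
    (act hw s φ h).1 (X.starMulSelf (star s)) = true := by
  rw [act_apply, conj_starMulSelf_star hw, h]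

theorem act_star_act (hw : X.WeaklyLeftResolving) (s : X.Semi) (φ : CharacterSpace X.Idem)
    (h : φ.1 (X.starMulSelf s) = true) :
    act hw (star s) (act hw s φ h) (act_starMulSelf_star hw s φ h) = φ := by
  refine Subtype.ext (funext fun e => ?_)
  rw [act_apply, act_apply, conj_star_conj hw, φ.2.map_mul, h, Bool.and_true]

theorem act_act_star (hw : X.WeaklyLeftResolving) (s : X.Semi) (φ : CharacterSpace X.Idem)
    (h : φ.1 (X.starMulSelf (star s)) = true)
    (h' : (act hw (star s) φ h).1 (X.starMulSelf s) = true) :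
    act hw s (act hw (star s) φ h) h' = φ := by
  refine Subtype.ext (funext fun e => ?_)
  rw [act_apply, act_apply]
  nth_rewrite 2 [← star_star_semi s]
  rw [conj_star_conj hw, φ.2.map_mul, h, Bool.and_true]

theorem act_congr (hw : X.WeaklyLeftResolving) {s t : X.Semi} {φ : CharacterSpace X.Idem}
    (hs : φ.1 (X.starMulSelf s) = true) (ht : φ.1 (X.starMulSelf t) = true) {e : X.Idem}
    (he : φ.1 e = true) (h : s * e.1 = t * e.1) : act hw s φ hs = act hw t φ ht := by
  refine Subtype.ext (funext fun f => ?_)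
  have := congrArg φ.1 (conj_mul_eq_of_mul_eq hw h f)
  rwa [φ.2.map_mul, φ.2.map_mul, he, Bool.and_true, Bool.and_true] at this

theorem starMulSelf_mul_iff (hw : X.WeaklyLeftResolving) {s t : X.Semi}
    {φ : CharacterSpace X.Idem} (ht : φ.1 (X.starMulSelf t) = true) :
    φ.1 (X.starMulSelf (s * t)) = true ↔ (act hw t φ ht).1 (X.starMulSelf s) = true := by
  rw [act_apply, starMulSelf_mul hw]

theorem act_mul (hw : X.WeaklyLeftResolving) {s t : X.Semi} {φ : CharacterSpace X.Idem}
    (hst : φ.1 (X.starMulSelf (s * t)) = true) (ht : φ.1 (X.starMulSelf t) = true)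
    (hs : (act hw t φ ht).1 (X.starMulSelf s) = true) :
    act hw (s * t) φ hst = act hw s (act hw t φ ht) hs := by
  refine Subtype.ext (funext fun e => ?_)
  rw [act_apply, act_apply, act_apply, conj_semi_mul hw]

theorem act_idem (hw : X.WeaklyLeftResolving) (e : X.Idem) (φ : CharacterSpace X.Idem)
    (h : φ.1 (X.starMulSelf e.1) = true) : act hw e.1 φ h = φ := by
  refine Subtype.ext (funext fun f => ?_)
  rw [starMulSelf_idem hw] at h
  rw [act_apply, conj_idem hw, φ.2.map_mul, h, Bool.and_true]

/-- A filter containing the image can be pulled back along `s*` to a filter containing the original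
one; maximality there gives equality, and acting by `s` carries the equality over. -/
theorem isUltrafilter_act (hw : X.WeaklyLeftResolving) (s : X.Semi) (φ : CharacterSpace X.Idem)
    (h : φ.1 (X.starMulSelf s) = true) (hφ : IsSemilatticeUltrafilter φ.filter) :
    IsSemilatticeUltrafilter (act hw s φ h).filter := by
  refine ⟨isSemilatticeFilter_filter _, fun ζ hζ hsub => ?_⟩
  obtain ⟨ψ, rfl⟩ := exists_filter_eq hw hζ
  -- The larger filter still contains `s s*`, so `s*` acts on it.
  have h1 : ψ.1 (X.starMulSelf (star s)) = true := hsub (act_starMulSelf_star hw s φ h)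
  have h2 : φ.filter ⊆ (act hw (star s) ψ h1).filter := by
    intro e he
    rw [← act_star_act hw s φ h] at he
    exact hsub he
  have h3 := filter_injective (hφ.2 _ (isSemilatticeFilter_filter _) h2)
  have h4 : (act hw (star s) ψ h1).1 (X.starMulSelf s) = true := by
    rw [h3]
    exact h
  rw [← act_act_star hw s ψ h1 h4]
  congr 2

theorem continuous_act (hw : X.WeaklyLeftResolving) (s : X.Semi) :
    Continuous fun φ : {φ : CharacterSpace X.Idem // φ.1 (X.starMulSelf s) = true} =>
      act hw s φ.1 φ.2 := by
  refine Continuous.subtype_mk (continuous_pi fun e => ?_) _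
  exact (continuous_apply (X.conj s e)).comp (continuous_subtype_val.comp continuous_subtype_val)

theorem isClopen_character (e : X.Idem) : IsClopen {φ : CharacterSpace X.Idem | φ.1 e = true} :=
  (isClopen_discrete {true}).preimage ((continuous_apply e).comp continuous_subtype_val)

/-- The domain of the action is open among all characters, so the preimage of a neighbourhood of the
image is a neighbourhood of `φ`. It contains an ultrafilter, which is carried to an ultrafilter. -/
theorem act_mem_tightSpectrum (hw : X.WeaklyLeftResolving) (s : X.Semi)
    {φ : CharacterSpace X.Idem} (h : φ.1 (X.starMulSelf s) = true)
    (hφ : φ ∈ tightSpectrum X.Idem) : act hw s φ h ∈ tightSpectrum X.Idem := by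
  refine mem_closure_iff.2 fun O hO hmem => ?_
  have h1 := (isClopen_character (X.starMulSelf s)).2.isOpenMap_subtype_val _
    (hO.preimage (continuous_act hw s))
  obtain ⟨ψ, ⟨⟨ψ', h2⟩, h3, rfl⟩, h4⟩ := mem_closure_iff.1 hφ _ h1 ⟨⟨φ, h⟩, hmem, rfl⟩
  exact ⟨act hw s ψ' h2, h3, isUltrafilter_act hw s ψ' h2 h4⟩

/-- The action of `s` on the tight characters with `φ(s* s) = 1`. -/
noncomputable def tact (hw : X.WeaklyLeftResolving) (s : X.Semi) (φ : X.TightCharacter)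
    (h : φ ∈ X.dom (X.starMulSelf s)) : X.TightCharacter :=
  ⟨act hw s φ.1 h, act_mem_tightSpectrum hw s h φ.2⟩

theorem tact_mem_dom (hw : X.WeaklyLeftResolving) (s : X.Semi) (φ : X.TightCharacter)
    (h : φ ∈ X.dom (X.starMulSelf s)) : tact hw s φ h ∈ X.dom (X.starMulSelf (star s)) :=
  act_starMulSelf_star hw s φ.1 h

theorem tact_star_tact (hw : X.WeaklyLeftResolving) (s : X.Semi) (φ : X.TightCharacter)
    (h : φ ∈ X.dom (X.starMulSelf s)) :
    tact hw (star s) (tact hw s φ h) (tact_mem_dom hw s φ h) = φ :=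
  Subtype.ext (act_star_act hw s φ.1 h)

theorem continuous_tact (hw : X.WeaklyLeftResolving) (s : X.Semi) :
    Continuous fun φ : X.dom (X.starMulSelf s) => tact hw s φ.1 φ.2 := by
  refine Continuous.subtype_mk ?_ _
  exact (continuous_act hw s).comp (Continuous.subtype_mk
    (continuous_subtype_val.comp continuous_subtype_val) fun φ => φ.2)

end LabelledSpace

/-! ## Words -/

namespace LWord

variable {Alph : Type*}

theorem isBeginning_append_iff (γ δ : List Alph) (w : LWord Alph) :
    IsBeginning (γ ++ δ) (append γ w) ↔ IsBeginning δ w := by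
  constructor
  · rintro ⟨w', h⟩
    rw [append_append] at h
    exact ⟨w', append_cancel γ h⟩
  · rintro ⟨w', rfl⟩
    exact ⟨w', (append_append _ _ _).symm⟩

theorem isBeginning_nil (w : LWord Alph) : IsBeginning [] w := ⟨w, (append_nil w).symm⟩

theorem isBeginning_append_self (γ : List Alph) (w : LWord Alph) :
    IsBeginning γ (append γ w) := ⟨w, rfl⟩

theorem isBeginning_iff (β : List Alph) (w : LWord Alph) :
    IsBeginning β w ↔ w.take β.length = β := by
  refine ⟨fun h => h.eq_take.2, fun h => ?_⟩
  rw [← h]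
  exact isBeginning_take _ _

theorem take_append_of_le {γ : List Alph} {i : ℕ} (h : i ≤ γ.length) (w : LWord Alph) :
    (append γ w).take i = γ.take i := by
  have h1 : IsBeginning (γ.take i) (append γ w) :=
    ⟨append (γ.drop i) w, by rw [← append_append, List.take_append_drop]⟩
  have h2 := h1.eq_take.2
  rwa [List.length_take_of_le h] at h2

theorem take_zero (w : LWord Alph) : w.take 0 = [] := by cases w <;> simp [take]

/-- A chain of words closed under beginnings either has a longest member, which is then the word
sought, or has members of every length, which are the beginnings of a stream. -/
theorem exists_isBeginning_iff {P : List Alph → Prop} (h0 : P [])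
    (hpre : ∀ α β, P (α ++ β) → P α) (hcomp : ∀ α β, P α → P β → α <+: β ∨ β <+: α) :
    ∃ w : LWord Alph, ∀ β, IsBeginning β w ↔ P β := by
  have hle : ∀ {α β}, P α → P β → α.length ≤ β.length → α <+: β := by
    intro α β hα hβ h
    rcases hcomp α β hα hβ with h1 | h1
    · exact h1
    · rw [h1.eq_of_length_le h]
  by_cases hb : ∃ N, ∀ β, P β → β.length ≤ N
  · classical
    -- The least bound on the lengths is attained: otherwise it is positive, because of the empty
    -- word, and could be lowered by one.
    have hex : ∃ N, ∃ l, P l ∧ l.length = N ∧ ∀ β, P β → β.length ≤ N := by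
      have hN := Nat.find_spec hb
      by_contra hcon
      push Not at hcon
      have hlt : ∀ β, P β → β.length < Nat.find hb := fun β hβ =>
        lt_of_le_of_ne (hN β hβ) fun h => by
          obtain ⟨γ, hγ, hγ'⟩ := hcon _ β hβ h
          exact absurd (hN γ hγ) (by omega)
      have hpos : 0 < Nat.find hb := hlt [] h0
      refine Nat.find_min hb (m := Nat.find hb - 1) (by omega) fun β hβ => ?_
      have := hlt β hβ
      omega
    obtain ⟨N, l, hl, rfl, hmax⟩ := hex
    refine ⟨fin l, fun β => ⟨?_, fun hβ => ?_⟩⟩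
    · intro h
      obtain ⟨h1, h2⟩ := h.eq_take
      simp only [take] at h2
      refine hpre β (l.drop β.length) ?_
      nth_rewrite 1 [← h2]
      rwa [List.take_append_drop]
    · obtain ⟨ζ, rfl⟩ := hle hβ hl (hmax β hβ)
      exact ⟨fin ζ, rfl⟩
  · push Not at hb
    have hex : ∀ n, ∃ β, P β ∧ β.length = n := fun n => by
      obtain ⟨β, hβ, hn⟩ := hb n
      refine ⟨β.take n, hpre _ (β.drop n) (by rwa [List.take_append_drop]), ?_⟩
      rw [List.length_take_of_le hn.le]
    choose b hb1 hb2 using hex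
    -- Letter `i` is read from the chosen word of length `i + 1`, the shortest one that has such a
    -- letter.
    let x : Stream' Alph := fun i => (b (i + 1))[i]'(by rw [hb2]; omega)
    have hx : ∀ n, Stream'.take n x = b n := fun n => by
      refine List.ext_getElem (by rw [Stream'.length_take, hb2]) fun i h1 h2 => ?_
      have hin : i < n := by rwa [hb2] at h2
      have h4 : (Stream'.take n x)[i] = x.get i := by
        rw [← Option.some_inj, ← List.getElem?_eq_getElem, Stream'.getElem?_take hin]
      rw [h4]
      have h3 : b (i + 1) <+: b n := hle (hb1 _) (hb1 _) (by rw [hb2, hb2]; omega)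
      exact h3.getElem _
    refine ⟨inf x, fun β => ?_⟩
    rw [isBeginning_iff]
    simp only [take, hx]
    constructor
    · intro h
      rw [← h]
      exact hb1 _
    · intro h
      exact (hle (hb1 _) h (by rw [hb2])).eq_of_length (hb2 _)

end LWord

namespace LabelledSpace

variable {V Edge Alph : Type*} {X : LabelledSpace V Edge Alph}

/-! ## Filters and their families -/

variable (X) in
/-- The idempotent `(α, A, α)` belongs to `ξ`. -/
def At (ξ : Set X.Idem) (α : List Alph) (A : Set V) : Prop := ∃ e ∈ ξ, e.1.1 = some (α, A, α)

theorem At.isTriple {ξ : Set X.Idem} {α : List Alph} {A : Set V} (h : X.At ξ α A) :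
    X.IsTriple (α, A, α) := by
  obtain ⟨e, -, he⟩ := h
  exact e.1.2 _ he

theorem At.mem_of_eq {ξ : Set X.Idem} {α : List Alph} {A : Set V} (h : X.At ξ α A) {e : X.Idem}
    (he : e.1.1 = some (α, A, α)) : e ∈ ξ := by
  obtain ⟨f, hf, hf'⟩ := h
  have : f = e := Subtype.ext (Subtype.ext (hf'.trans he.symm))
  rwa [← this]

theorem exists_at_of_mem {ξ : Set X.Idem} (hξ : IsSemilatticeFilter ξ) {e : X.Idem} (he : e ∈ ξ) :
    ∃ α A, e.1.1 = some (α, A, α) ∧ X.At ξ α A := by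
  rcases idem_eq_zero_or e with rfl | ⟨α, A, h⟩
  · exact absurd he hξ.zero_notMem
  · exact ⟨α, A, h, e, he, h⟩

theorem supp_nonempty {ξ : Set X.Idem} (hξ : IsSemilatticeFilter ξ) {e : X.Idem} (he : e ∈ ξ) :
    (X.supp e).Nonempty := by
  by_contra h
  rw [Set.not_nonempty_iff_eq_empty, ← supp_zero] at h
  exact hξ.zero_notMem (supp_ext h ▸ he)

/-- Upward closure, phrased on points. Non-emptiness of `A` comes for free: `e` is non-zero in a
proper filter, and any point of its support yields a vertex in a relative range of `A`. -/
theorem at_of_supp_subset (hw : X.WeaklyLeftResolving) {ξ : Set X.Idem}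
    (hξ : IsSemilatticeFilter ξ) {e : X.Idem} (he : e ∈ ξ) {α : List Alph} {A : Set V}
    (hA : A ∈ X.famAt α)
    (h : ∀ x v, (x, v) ∈ X.supp e → ∃ δ, x = α ++ δ ∧ v ∈ X.relRange A δ) : X.At ξ α A := by
  obtain ⟨⟨x, v⟩, hp⟩ := supp_nonempty hξ he
  obtain ⟨δ, -, hv⟩ := h x v hp
  have hne : A.Nonempty := X.nonempty_of_relRange ⟨v, hv⟩
  refine ⟨X.idem α A (isTriple_of_subset hA.1 hA.2 hA.2 hne), filter_mono hw hξ he ?_, rfl⟩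
  rintro ⟨y, u⟩ hq
  exact (X.mem_supp_of_eq rfl).2 (h y u hq)

theorem At.mono (hw : X.WeaklyLeftResolving) {ξ : Set X.Idem} (hξ : IsSemilatticeFilter ξ)
    {α : List Alph} {A B : Set V} (h : X.At ξ α A) (hB : B ∈ X.famAt α) (hAB : A ⊆ B) :
    X.At ξ α B := by
  obtain ⟨e, he, he'⟩ := h
  refine at_of_supp_subset hw hξ he hB fun x v hp => ?_
  obtain ⟨δ, h1, h2⟩ := (X.mem_supp_of_eq he').1 hp
  exact ⟨δ, h1, X.relRange_mono hAB δ h2⟩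

theorem At.of_append (hw : X.WeaklyLeftResolving) {ξ : Set X.Idem} (hξ : IsSemilatticeFilter ξ)
    {α δ : List Alph} {A B : Set V} (h : X.At ξ (α ++ δ) B) (hA : A ∈ X.famAt α)
    (hAB : B ⊆ X.relRange A δ) : X.At ξ α A := by
  obtain ⟨e, he, he'⟩ := h
  refine at_of_supp_subset hw hξ he hA fun x v hp => ?_
  obtain ⟨ε, h1, h2⟩ := (X.mem_supp_of_eq he').1 hp
  refine ⟨δ ++ ε, by simpa using h1, ?_⟩
  rw [X.relRange_append]
  exact X.relRange_mono hAB ε h2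

/-- This is the product of the two idempotents; it is non-zero because both lie in one filter. -/
theorem At.inter (hw : X.WeaklyLeftResolving) {ξ : Set X.Idem} (hξ : IsSemilatticeFilter ξ)
    {α δ : List Alph} {A B : Set V} (h : X.At ξ α A) (h' : X.At ξ (α ++ δ) B) :
    X.At ξ (α ++ δ) (B ∩ X.relRange A δ) := by
  have hA := h.isTriple.2.2.1
  have hB := h'.isTriple.2.2.1
  obtain ⟨e, he, he'⟩ := h
  obtain ⟨f, hf, hf'⟩ := h'
  have hef := hξ.mul_mem e he f hf
  have key : ∀ x v, (x, v) ∈ X.supp (e * f) →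
      ∃ ε, x = α ++ δ ++ ε ∧ v ∈ X.relRange (X.relRange A δ) ε ∧ v ∈ X.relRange B ε := by
    intro x v hp
    rw [supp_mul hw] at hp
    obtain ⟨ζ, h1, h2⟩ := (X.mem_supp_of_eq he').1 hp.1
    obtain ⟨ε, h3, h4⟩ := (X.mem_supp_of_eq hf').1 hp.2
    simp only at h1 h2 h3 h4
    obtain rfl : ζ = δ ++ ε := by simpa [h3] using h1.symm
    rw [X.relRange_append] at h2
    exact ⟨ε, h3, h2, h4⟩
  obtain ⟨⟨x, v⟩, hp⟩ := supp_nonempty hξ hef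
  obtain ⟨ε, -, hv, -⟩ := key x v hp
  have hm := X.relRange_mem_of_nonempty hA.1 (X.nonempty_of_relRange ⟨v, hv⟩)
  refine at_of_supp_subset hw hξ hef
    ⟨X.inter_mem _ hB.1 _ hm, Set.inter_subset_left.trans hB.2⟩ fun y u hq => ?_
  obtain ⟨ε, h1, h2, h3⟩ := key y u hq
  refine ⟨ε, h1, ?_⟩
  rw [hw.relRange_inter hB.1 hm]
  exact ⟨h3, h2⟩

theorem At.prefix_or (hw : X.WeaklyLeftResolving) {ξ : Set X.Idem} (hξ : IsSemilatticeFilter ξ)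
    {α β : List Alph} {A B : Set V} (h : X.At ξ α A) (h' : X.At ξ β B) :
    α <+: β ∨ β <+: α := by
  obtain ⟨e, he, he'⟩ := h
  obtain ⟨f, hf, hf'⟩ := h'
  obtain ⟨⟨x, v⟩, hp⟩ := supp_nonempty hξ (hξ.mul_mem e he f hf)
  rw [supp_mul hw] at hp
  obtain ⟨ζ, h1, -⟩ := (X.mem_supp_of_eq he').1 hp.1
  obtain ⟨ε, h3, -⟩ := (X.mem_supp_of_eq hf').1 hp.2
  rcases List.append_eq_append_iff.1 (h1.symm.trans h3) with ⟨a, h, -⟩ | ⟨a, h, -⟩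
  · exact Or.inl ⟨a, h.symm⟩
  · exact Or.inr ⟨a, h.symm⟩

theorem range_mem_famAt {α : List Alph} (h0 : α ≠ []) (h : (X.range α).Nonempty) :
    X.range α ∈ X.famAt α :=
  ⟨X.range_mem α (X.mem_labelledPaths_of_relRange h) h0, subset_rfl⟩

/-- The words occurring in a filter are pairwise comparable, since products in it are non-zero. They
are closed under non-empty beginnings because `(α, r(α), α)` lies above every `(αβ, B, αβ)`. -/
theorem exists_hasWord (hw : X.WeaklyLeftResolving) {ξ : Set X.Idem}
    (hξ : IsSemilatticeFilter ξ) : ∃ w, X.HasWord ξ w := by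
  refine LWord.exists_isBeginning_iff (Or.inl rfl) ?_ ?_
  · rintro α β h
    by_cases h0 : α = []
    · exact Or.inl h0
    rcases h with h | ⟨e, he, B, hB⟩
    · exact Or.inl (List.append_eq_nil_iff.1 h).1
    · have hat : X.At ξ (α ++ β) B := ⟨e, he, hB⟩
      have h1 := hat.isTriple.2.2.1.2
      rw [X.range_append] at h1
      have hne : (X.range α).Nonempty :=
        X.nonempty_of_relRange (hat.isTriple.2.2.2.2.mono h1)
      obtain ⟨f, hf, hf'⟩ := hat.of_append hw hξ (range_mem_famAt h0 hne) h1
      exact Or.inr ⟨f, hf, _, hf'⟩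
  · rintro α β (rfl | ⟨e, he, A, hA⟩) (rfl | ⟨f, hf, B, hB⟩)
    · simp
    · simp
    · simp
    · exact At.prefix_or hw hξ ⟨e, he, hA⟩ ⟨f, hf, hB⟩

theorem At.isBeginning {ξ : Set X.Idem} {w : LWord Alph} (hword : X.HasWord ξ w) {α : List Alph}
    {A : Set V} (h : X.At ξ α A) : LWord.IsBeginning α w := by
  obtain ⟨e, he, he'⟩ := h
  exact (hword α).2 (Or.inr ⟨e, he, A, he'⟩)

theorem HasWord.exists_at {ξ : Set X.Idem} {w : LWord Alph} (hword : X.HasWord ξ w)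
    {α : List Alph} (h : LWord.IsBeginning α w) (h0 : α ≠ []) : ∃ A, X.At ξ α A := by
  rcases (hword α).1 h with h | ⟨e, he, A, hA⟩
  · exact absurd h h0
  · exact ⟨A, e, he, hA⟩

theorem At.exists_hasWord_append (hw : X.WeaklyLeftResolving) {ξ : Set X.Idem}
    (hξ : IsSemilatticeFilter ξ) {α : List Alph} {A : Set V} (h : X.At ξ α A) :
    ∃ w : LWord Alph, X.HasWord ξ (w.append α) := by
  obtain ⟨w, hword⟩ := exists_hasWord hw hξ
  obtain ⟨w', rfl⟩ := h.isBeginning hword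
  exact ⟨w', hword⟩

/-! ## Cutting and gluing -/

/-- One description for both clauses of the definition: for empty `γ` the formula returns `ξ` itself
because `ξ` is closed upwards. -/
theorem mem_cut (hw : X.WeaklyLeftResolving) {ξ : Set X.Idem} (hξ : IsSemilatticeFilter ξ)
    {γ : List Alph} {w : LWord Alph} (hword : X.HasWord ξ (w.append γ)) {e : X.Idem} :
    e ∈ X.cut γ w ξ ↔
      ∃ δ C D, e.1.1 = some (δ, C, δ) ∧ X.At ξ (γ ++ δ) D ∧ D ⊆ C := by
  by_cases hγ : γ = []
  · subst hγ
    simp only [cut, if_true, List.nil_append]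
    constructor
    · intro he
      obtain ⟨α, A, h1, h2⟩ := exists_at_of_mem hξ he
      exact ⟨α, A, A, h1, h2, subset_rfl⟩
    · rintro ⟨δ, C, D, h1, h2, h3⟩
      exact (h2.mono hw hξ (e.1.2 _ h1).2.2.1 h3).mem_of_eq h1
  · simp only [cut, hγ, if_false]
    constructor
    · rintro ⟨n, hn, C, ⟨hC, D, hD, hDC⟩, he⟩
      simp only [family, LWord.take_append] at hD
      exact ⟨_, C, D, he, hD, hDC⟩
    · rintro ⟨δ, C, D, h1, h2, h3⟩
      have hb := ((LWord.isBeginning_append_iff _ _ _).1 (h2.isBeginning hword)).eq_take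
      refine ⟨δ.length, hb.1, C, ⟨?_, D, ?_, h3⟩, ?_⟩
      · rw [hb.2]
        exact (e.1.2 _ h1).2.2.1
      · simp only [family, LWord.take_append, hb.2]
        exact h2
      · rw [hb.2]
        exact h1

theorem at_cut (hw : X.WeaklyLeftResolving) {ξ : Set X.Idem} (hξ : IsSemilatticeFilter ξ)
    {γ : List Alph} {w : LWord Alph} (hword : X.HasWord ξ (w.append γ)) {δ : List Alph}
    {C : Set V} : X.At (X.cut γ w ξ) δ C ↔ C ∈ X.famAt δ ∧ ∃ D ⊆ C, X.At ξ (γ ++ δ) D := by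
  constructor
  · rintro ⟨e, he, he'⟩
    obtain ⟨δ', C', D, h1, h2, h3⟩ := (mem_cut hw hξ hword).1 he
    rw [he'] at h1
    cases h1
    exact ⟨(e.1.2 _ he').2.2.1, D, h3, h2⟩
  · rintro ⟨h1, D, h2, h3⟩
    exact ⟨X.idem δ C (isTriple_of_subset h1.1 h1.2 h1.2 (h3.isTriple.2.2.2.2.mono h2)),
      (mem_cut hw hξ hword).2 ⟨δ, C, D, rfl, h3, h2⟩, rfl⟩

theorem ofFamily_family {ξ : Set X.Idem} (hξ : IsSemilatticeFilter ξ) {w : LWord Alph}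
    (hword : X.HasWord ξ w) : X.ofFamily w (X.family w ξ) = ξ := by
  ext e
  constructor
  · rintro ⟨n, -, A, hA, he⟩
    exact At.mem_of_eq hA he
  · intro he
    obtain ⟨α, A, h1, h2⟩ := exists_at_of_mem hξ he
    obtain ⟨hl, ht⟩ := (h2.isBeginning hword).eq_take
    refine ⟨α.length, hl, A, ?_, ?_⟩
    · simp only [family, ht]
      exact h2
    · rw [ht]
      exact h1

theorem ofFamily_congr {w : LWord Alph} {F F' : ℕ → Set (Set V)}
    (h : ∀ n : ℕ, (n : ℕ∞) ≤ w.length → F n = F' n) : X.ofFamily w F = X.ofFamily w F' := by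
  ext e
  constructor
  · rintro ⟨n, hn, A, hA, he⟩
    exact ⟨n, hn, A, h n hn ▸ hA, he⟩
  · rintro ⟨n, hn, A, hA, he⟩
    exact ⟨n, hn, A, (h n hn).symm ▸ hA, he⟩

/-- Cutting enlarges a level of `ξ` only by supersets that may leave `r(γδ)`. Intersecting with
`r(γδ)` undoes this, since the result still contains a member of that level of `ξ`. -/
theorem glueAt_family_cut (hw : X.WeaklyLeftResolving) {ξ : Set X.Idem}
    (hξ : IsSemilatticeFilter ξ) {γ : List Alph} (hγ : γ ≠ []) {w : LWord Alph}
    (hword : X.HasWord ξ (w.append γ)) (n : ℕ) :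
    X.glueAt (γ ++ w.take n) (X.family w (X.cut γ w ξ) n) = {A | X.At ξ (γ ++ w.take n) A} := by
  ext A
  constructor
  · rintro ⟨C, hC, rfl⟩
    obtain ⟨h1, D, h2, h3⟩ := (at_cut hw hξ hword).1 hC
    have hD := h3.isTriple.2.2.1
    have hr := range_mem_famAt (by simp [hγ]) (h3.isTriple.2.2.2.2.mono hD.2)
    exact h3.mono hw hξ ⟨X.inter_mem _ h1.1 _ hr.1, Set.inter_subset_right⟩
      (Set.subset_inter h2 hD.2)
  · intro hA
    have hA' := At.isTriple hA
    refine ⟨A, (at_cut hw hξ hword).2 ⟨⟨hA'.2.2.1.1, ?_⟩, A, subset_rfl, hA⟩, ?_⟩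
    · exact hA'.2.2.1.2.trans (X.range_append_subset _ _)
    · exact (Set.inter_eq_left.2 hA'.2.2.1.2).symm

/-- The level at `xy` determines the level at `x`. That something occurs at `xy` is needed so that
`r(A, y)` is met by a member of the filter and hence is non-empty. -/
theorem dropEnd_at (hw : X.WeaklyLeftResolving) {ξ : Set X.Idem} (hξ : IsSemilatticeFilter ξ)
    {x y : List Alph} (h : ∃ B, X.At ξ (x ++ y) B) :
    X.dropEnd x y {A | X.At ξ (x ++ y) A} = {A | X.At ξ x A} := by
  ext A
  constructor
  · rintro ⟨h1, h2⟩
    exact At.of_append hw hξ h2 h1 subset_rfl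
  · intro hA
    obtain ⟨B, hB⟩ := h
    have h1 := At.inter hw hξ hA hB
    have hA' := (At.isTriple hA).2.2.1
    refine ⟨hA', h1.mono hw hξ ⟨?_, X.relRange_subset_range_append hA'.2⟩ Set.inter_subset_right⟩
    exact X.relRange_mem_of_nonempty hA'.1 (h1.isTriple.2.2.2.2.mono Set.inter_subset_right)

/-- Tightness plays no role here. The use is uniqueness: a filter with word `γw` is determined by
its cut at `γ`. -/
theorem glue_cut (hw : X.WeaklyLeftResolving) {ξ : Set X.Idem} (hξ : IsSemilatticeFilter ξ)
    {γ : List Alph} {w : LWord Alph} (hword : X.HasWord ξ (w.append γ)) :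
    X.glue γ w (X.cut γ w ξ) = ξ := by
  by_cases hγ : γ = []
  · subst hγ
    simp [glue, cut]
  have hat : ∀ n, ∃ B, X.At ξ (γ ++ w.take n) B := fun n =>
    hword.exists_at ((LWord.isBeginning_append_iff _ _ _).2 (LWord.isBeginning_take _ _))
      (by simp [hγ])
  have hdrop : ∀ i n, X.dropEnd (γ.take i) (γ.drop i ++ w.take n)
      {A | X.At ξ (γ ++ w.take n) A} = {A | X.At ξ (γ.take i) A} := fun i n => by
    have h1 : γ ++ w.take n = γ.take i ++ (γ.drop i ++ w.take n) := by
      rw [← List.append_assoc, List.take_append_drop]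
    rw [h1]
    refine dropEnd_at hw hξ ?_
    rw [← h1]
    exact hat n
  rw [glue, if_neg hγ]
  conv_rhs => rw [← ofFamily_family hξ hword]
  refine ofFamily_congr fun i hi => ?_
  have hfam : X.family (w.append γ) ξ i = {A | X.At ξ ((w.append γ).take i) A} := rfl
  rw [hfam, glueFamily]
  -- For empty `w` the glued level is `|γ|` itself and smaller levels descend from it. For non-empty
  -- `w` every level up to and including `|γ|` descends from level `|γ| + 1`.
  split_ifs with h1 h2 h3
  · have hg := glueAt_family_cut hw hξ hγ hword 0
    have hd := hdrop i 0
    rw [LWord.take_zero, List.append_nil] at hg hd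
    rw [List.append_nil] at hd
    rw [hg, hd, LWord.take_append_of_le h2.le]
  · have hg := glueAt_family_cut hw hξ hγ hword 0
    rw [LWord.take_zero, List.append_nil] at hg
    rw [LWord.length_append] at hi
    have hi' : i ≤ γ.length := by
      rw [h1] at hi
      simpa [LWord.length] using hi
    obtain rfl : i = γ.length := by omega
    rw [hg, LWord.take_append_of_le le_rfl, List.take_length]
  · rw [glueAt_family_cut hw hξ hγ hword, hdrop, LWord.take_append_of_le h3]
  · rw [glueAt_family_cut hw hξ hγ hword, ← LWord.take_append, Nat.sub_add_cancel (by omega)]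

/-! ## The action in terms of families -/

theorem at_starMulSelf {s : X.Semi} {β γ : List Alph} {A : Set V} (hs : s.1 = some (β, A, γ))
    {φ : CharacterSpace X.Idem} (h : φ.1 (X.starMulSelf s) = true) : X.At φ.filter γ A :=
  ⟨_, h, starMulSelf_eq hs⟩

/-- For `e = (βδ, D, βδ)` the support of `s* e s` consists of words beginning with `γδ` and vertices
reached from both `D` and `r(A, δ)`. The intersection with `r(A, δ)` also ensures containment in
`r(γδ)`. -/
theorem at_of_at_act (hw : X.WeaklyLeftResolving) {s : X.Semi} {β γ : List Alph} {A : Set V}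
    (hs : s.1 = some (β, A, γ)) (φ : CharacterSpace X.Idem) (h : φ.1 (X.starMulSelf s) = true)
    {δ : List Alph} {D : Set V} (hD : X.At (act hw s φ h).filter (β ++ δ) D) :
    X.At φ.filter (γ ++ δ) (D ∩ X.relRange A δ) := by
  have hD' := hD.isTriple.2.2.1
  obtain ⟨-, -, -, hA, -⟩ := s.2 _ hs
  simp only at hA
  obtain ⟨e, he, he'⟩ := hD
  have hφ := isSemilatticeFilter_filter φ
  have hc : X.conj s e ∈ φ.filter := he
  have key : ∀ x v, (x, v) ∈ X.supp (X.conj s e) →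
      ∃ ε, x = γ ++ δ ++ ε ∧ v ∈ X.relRange D ε ∧ v ∈ X.relRange (X.relRange A δ) ε := by
    intro x v hp
    obtain ⟨⟨y, u⟩, h1, h2⟩ := (mem_supp_conj hw).1 hp
    obtain ⟨ε, h3, h4⟩ := (X.mem_supp_of_eq he').1 h1
    obtain ⟨ζ, h5, h6, h7, h8⟩ := (Rel.of_eq X hs).1 h2
    simp only at h3 h4 h5 h6 h7 h8
    subst h7
    obtain rfl : ζ = δ ++ ε := by simpa [h3] using h5.symm
    rw [X.relRange_append] at h8
    exact ⟨ε, by rw [h6, List.append_assoc], h4, h8⟩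
  obtain ⟨⟨x, v⟩, hp⟩ := supp_nonempty hφ hc
  obtain ⟨ε, -, -, hv⟩ := key x v hp
  have hm := X.relRange_mem_of_nonempty hA.1 (X.nonempty_of_relRange ⟨v, hv⟩)
  refine at_of_supp_subset hw hφ hc ⟨X.inter_mem _ hD'.1 _ hm,
    Set.inter_subset_right.trans (X.relRange_subset_range_append hA.2)⟩ fun y u hq => ?_
  obtain ⟨ε, h1, h2, h3⟩ := key y u hq
  refine ⟨ε, h1, ?_⟩
  rw [hw.relRange_inter hD'.1 hm]
  exact ⟨h2, h3⟩

/-- The preceding lemma for `s*`, which carries the image back to `φ`. -/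
theorem at_act_of_at (hw : X.WeaklyLeftResolving) {s : X.Semi} {β γ : List Alph} {A : Set V}
    (hs : s.1 = some (β, A, γ)) (φ : CharacterSpace X.Idem) (h : φ.1 (X.starMulSelf s) = true)
    {δ : List Alph} {D : Set V} (hD : X.At φ.filter (γ ++ δ) D) :
    X.At (act hw s φ h).filter (β ++ δ) (D ∩ X.relRange A δ) := by
  refine at_of_at_act hw (star_eq hs) (act hw s φ h) (act_starMulSelf_star hw s φ h) ?_
  rwa [act_star_act]

theorem hasWord_act (hw : X.WeaklyLeftResolving) {s : X.Semi} {β γ : List Alph} {A : Set V}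
    (hs : s.1 = some (β, A, γ)) (φ : CharacterSpace X.Idem) (h : φ.1 (X.starMulSelf s) = true)
    {w : LWord Alph} (hword : X.HasWord φ.filter (w.append γ)) :
    X.HasWord (act hw s φ h).filter (w.append β) := by
  obtain ⟨w', hword'⟩ := (at_starMulSelf (star_eq hs)
    (act_starMulSelf_star hw s φ h)).exists_hasWord_append hw (isSemilatticeFilter_filter _)
  have : w = w' := LWord.eq_of_isBeginning_iff fun δ => by
    by_cases h0 : δ = []
    · subst h0
      exact ⟨fun _ => LWord.isBeginning_nil _, fun _ => LWord.isBeginning_nil _⟩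
    rw [← LWord.isBeginning_append_iff γ δ, ← LWord.isBeginning_append_iff β δ]
    constructor
    · intro hb
      obtain ⟨D, hD⟩ := hword.exists_at hb (by simp [h0])
      exact (at_act_of_at hw hs φ h hD).isBeginning hword'
    · intro hb
      obtain ⟨D, hD⟩ := hword'.exists_at hb (by simp [h0])
      exact (at_of_at_act hw hs φ h hD).isBeginning hword
  rw [this]
  exact hword'

/-- The action changes a member `D` only by shrinking it to `D ∩ r(A, δ)`, and a cut filter sees
only which sets contain some member. -/
theorem cut_act (hw : X.WeaklyLeftResolving) {s : X.Semi} {β γ : List Alph} {A : Set V}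
    (hs : s.1 = some (β, A, γ)) (φ : CharacterSpace X.Idem) (h : φ.1 (X.starMulSelf s) = true)
    {w : LWord Alph} (hword : X.HasWord φ.filter (w.append γ)) :
    X.cut β w (act hw s φ h).filter = X.cut γ w φ.filter := by
  ext e
  rw [mem_cut hw (isSemilatticeFilter_filter _) (hasWord_act hw hs φ h hword),
    mem_cut hw (isSemilatticeFilter_filter _) hword]
  constructor
  · rintro ⟨δ, C, D, h1, h2, h3⟩
    exact ⟨δ, C, _, h1, at_of_at_act hw hs φ h h2, Set.inter_subset_left.trans h3⟩
  · rintro ⟨δ, C, D, h1, h2, h3⟩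
    exact ⟨δ, C, _, h1, at_act_of_at hw hs φ h h2, Set.inter_subset_left.trans h3⟩

end LabelledSpace

namespace LabelledSpace

variable {V Edge Alph : Type*} {X : LabelledSpace V Edge Alph}

/-! ## Germs as elements of `Γ` -/

/-- The degree `|β| - |γ|` of `(β, A, γ)`. -/
def degree (s : X.Semi) : ℤ := s.1.elim 0 fun t => (t.1.length : ℤ) - (t.2.2.length : ℤ)

theorem degree_eq {s : X.Semi} {β γ : List Alph} {A : Set V} (hs : s.1 = some (β, A, γ)) :
    degree s = (β.length : ℤ) - (γ.length : ℤ) := by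
  rw [degree, hs]
  rfl

/-- The degree is visible at any single related pair. Hence it is constant on germs and additive on
products that are defined at some character. -/
theorem Rel.degree_eq {s : X.Semi} {p q : List Alph × V} (h : X.Rel s p q) :
    degree s = (p.1.length : ℤ) - (q.1.length : ℤ) := by
  obtain ⟨⟨β, A, γ⟩, ht, δ, h1, h2, -, -⟩ := h
  rw [LabelledSpace.degree_eq ht, h1, h2]
  simp

theorem degree_idem (e : X.Idem) : degree e.1 = 0 := by
  rcases e.2 with h | ⟨α, A, h⟩
  · rw [degree, h]
    rfl
  · rw [degree_eq h, sub_self]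

theorem degree_star (s : X.Semi) : degree (star s) = -degree s := by
  by_cases h : s = 0
  · subst h
    rfl
  · obtain ⟨α, A, β, hs⟩ := semi_ne_zero_iff.1 h
    rw [degree_eq (star_eq hs), degree_eq hs, neg_sub]

theorem exists_rel (hw : X.WeaklyLeftResolving) {s : X.Semi} {φ : X.TightCharacter}
    (h : φ ∈ X.dom (X.starMulSelf s)) {e : X.Idem} (he : φ ∈ X.dom e) :
    ∃ p q, X.Rel s p q ∧ q ∈ X.supp e := by
  obtain ⟨q, hq⟩ := supp_nonempty (isSemilatticeFilter_filter φ.1)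
    ((character_mul_iff φ.1).2 ⟨h, he⟩)
  rw [supp_mul hw] at hq
  obtain ⟨p, hp⟩ := (mem_supp_starMulSelf hw).1 hq.1
  exact ⟨p, q, hp, hq.2⟩

theorem exists_eq_some {s : X.Semi} {φ : X.TightCharacter}
    (h : φ ∈ X.dom (X.starMulSelf s)) : ∃ β A γ, s.1 = some (β, A, γ) := by
  refine semi_ne_zero_iff.1 ?_
  rintro rfl
  exact (isSemilatticeFilter_filter φ.1).zero_notMem h

theorem degree_congr (hw : X.WeaklyLeftResolving) {s t : X.Semi} {φ : X.TightCharacter}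
    (h : φ ∈ X.dom (X.starMulSelf s)) {e : X.Idem} (he : φ ∈ X.dom e)
    (hst : s * e.1 = t * e.1) : degree s = degree t := by
  obtain ⟨p, q, h1, h2⟩ := exists_rel hw h he
  have h3 : X.Rel (t * e.1) p q := hst ▸ (rel_mul_idem hw).2 ⟨h1, h2⟩
  rw [h1.degree_eq, ((rel_mul_idem hw).1 h3).1.degree_eq]

theorem degree_mul (hw : X.WeaklyLeftResolving) {s t : X.Semi} {φ : X.TightCharacter}
    (h : φ ∈ X.dom (X.starMulSelf (s * t))) : degree (s * t) = degree s + degree t := by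
  obtain ⟨p, q, h1, -⟩ := exists_rel hw h h
  obtain ⟨m, h2, h3⟩ := (rel_mul X hw _ _ _ _).1 h1
  rw [h1.degree_eq, h2.degree_eq, h3.degree_eq]
  ring

theorem toFilter_injective : Function.Injective X.toFilter := fun _ _ h =>
  Subtype.ext (filter_injective (congrArg Subtype.val h))

theorem toFilter_surjective : Function.Surjective X.toFilter := by
  rintro ⟨_, φ, hφ, rfl⟩
  exact ⟨⟨φ, hφ⟩, rfl⟩

variable (X) in
/-- Tight characters correspond to tight filters. -/
noncomputable def toFilterEquiv : X.TightCharacter ≃ TightFilter X.Idem :=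
  Equiv.ofBijective X.toFilter ⟨toFilter_injective, toFilter_surjective⟩

variable (X) in
/-- The source of an element of `Γ`, as a tight character. -/
noncomputable def srcChar (g : X.Gamma) : X.TightCharacter := X.toFilterEquiv.symm g.1.2.2

variable (X) in
/-- The range of an element of `Γ`, as a tight character. -/
noncomputable def rngChar (g : X.Gamma) : X.TightCharacter := X.toFilterEquiv.symm g.1.1

theorem toFilter_srcChar (g : X.Gamma) : X.toFilter (X.srcChar g) = g.1.2.2 :=
  X.toFilterEquiv.apply_symm_apply _

theorem toFilter_rngChar (g : X.Gamma) : X.toFilter (X.rngChar g) = g.1.1 :=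
  X.toFilterEquiv.apply_symm_apply _

theorem srcChar_filter (g : X.Gamma) : (X.srcChar g).1.filter = g.1.2.2.1 :=
  congrArg Subtype.val (toFilter_srcChar g)

theorem rngChar_filter (g : X.Gamma) : (X.rngChar g).1.filter = g.1.1.1 :=
  congrArg Subtype.val (toFilter_rngChar g)

theorem mem_dom_iff {φ : X.TightCharacter} {e : X.Idem} : φ ∈ X.dom e ↔ e ∈ φ.1.filter := Iff.rfl

theorem gamma_ext {g h : X.Gamma} (h1 : X.rngChar g = X.rngChar h) (h2 : g.1.2.1 = h.1.2.1)
    (h3 : X.srcChar g = X.srcChar h) : g = h :=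
  Subtype.ext (Prod.ext (X.toFilterEquiv.symm.injective h1)
    (Prod.ext h2 (X.toFilterEquiv.symm.injective h3)))

theorem chart_mem (hw : X.WeaklyLeftResolving) (s : X.Semi) (φ : X.TightCharacter)
    (h : φ ∈ X.dom (X.starMulSelf s)) :
    (X.toFilter (tact hw s φ h), degree s, X.toFilter φ) ∈ X.Gamma := by
  obtain ⟨β, A, γ, hs⟩ := exists_eq_some h
  obtain ⟨w, hword⟩ :=
    (at_starMulSelf hs h).exists_hasWord_append hw (isSemilatticeFilter_filter φ.1)
  exact ⟨β, γ, w, hasWord_act hw hs φ.1 h hword, hword, degree_eq hs, cut_act hw hs φ.1 h hword⟩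

/-- The element of `Γ` that corresponds to the germ `[s, φ]`. -/
noncomputable def chart (hw : X.WeaklyLeftResolving) (s : X.Semi)
    (φ : X.dom (X.starMulSelf s)) : X.Gamma :=
  ⟨(X.toFilter (tact hw s φ.1 φ.2), degree s, X.toFilter φ.1), chart_mem hw s φ.1 φ.2⟩

theorem srcChar_chart (hw : X.WeaklyLeftResolving) (s : X.Semi) (φ : X.dom (X.starMulSelf s)) :
    X.srcChar (chart hw s φ) = φ.1 := X.toFilterEquiv.symm_apply_apply _

theorem rngChar_chart (hw : X.WeaklyLeftResolving) (s : X.Semi) (φ : X.dom (X.starMulSelf s)) :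
    X.rngChar (chart hw s φ) = tact hw s φ.1 φ.2 := X.toFilterEquiv.symm_apply_apply _

theorem chart_congr (hw : X.WeaklyLeftResolving) {s t : X.Semi} {φ : X.TightCharacter}
    (hs : φ ∈ X.dom (X.starMulSelf s)) (ht : φ ∈ X.dom (X.starMulSelf t)) {e : X.Idem}
    (he : φ ∈ X.dom e) (h : s * e.1 = t * e.1) : chart hw s ⟨φ, hs⟩ = chart hw t ⟨φ, ht⟩ := by
  refine gamma_ext ?_ (degree_congr hw hs he h) ?_
  · rw [rngChar_chart, rngChar_chart]
    exact Subtype.ext (act_congr hw hs ht he h)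
  · rw [srcChar_chart, srcChar_chart]

/-! ### Germs are determined by their image in `Γ` -/

/-- Both elements replace the beginning `γ` by `β` and keep the vertex, so they agree on the
intersection of their domains. -/
theorem mul_idem_eq_of_append (hw : X.WeaklyLeftResolving) {s t : X.Semi} {β γ δ : List Alph}
    {A B : Set V} (hs : s.1 = some (β, A, γ)) (ht : t.1 = some (β ++ δ, B, γ ++ δ)) :
    s * (X.starMulSelf s * X.starMulSelf t).1 = t * (X.starMulSelf s * X.starMulSelf t).1 := by
  refine rel_ext fun p q => ?_
  rw [rel_mul_idem hw, rel_mul_idem hw, supp_mul hw]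
  refine and_congr_left fun ⟨h1, h2⟩ => ?_
  obtain ⟨ζ, h3, h4⟩ := (X.mem_supp_of_eq (starMulSelf_eq hs)).1 h1
  obtain ⟨ε, h5, h6⟩ := (X.mem_supp_of_eq (starMulSelf_eq ht)).1 h2
  obtain ⟨x, v⟩ := p
  obtain ⟨y, u⟩ := q
  simp only at h3 h4 h5 h6
  obtain rfl : ζ = δ ++ ε := by simpa [h3] using h5
  rw [Rel.of_eq X hs, Rel.of_eq X ht]
  simp only
  constructor
  · rintro ⟨η, k1, k2, rfl, -⟩
    obtain rfl := List.append_cancel_left (k2.symm.trans h3)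
    exact ⟨ε, by rw [k1, List.append_assoc], h5, rfl, h6⟩
  · rintro ⟨η, k1, k2, rfl, -⟩
    obtain rfl := List.append_cancel_left (k2.symm.trans h5)
    exact ⟨δ ++ η, by rw [k1, List.append_assoc], h3, rfl, h4⟩

/-- Write `γ' = γδ`. Equal degrees give `|β'| = |βδ|`, and both `β'` and `βδ` are beginnings of the
word of the common range, so `β' = βδ`. -/
theorem exists_mul_eq_of_prefix (hw : X.WeaklyLeftResolving) {s t : X.Semi}
    {φ : X.TightCharacter} (hs : φ ∈ X.dom (X.starMulSelf s)) (ht : φ ∈ X.dom (X.starMulSelf t))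
    (h : chart hw s ⟨φ, hs⟩ = chart hw t ⟨φ, ht⟩) {β γ β' γ' : List Alph} {A A' : Set V}
    (hs' : s.1 = some (β, A, γ)) (ht' : t.1 = some (β', A', γ')) (hγ : γ <+: γ') :
    ∃ e : X.Idem, φ ∈ X.dom e ∧ s * e.1 = t * e.1 := by
  have hrng : tact hw s φ hs = tact hw t φ ht := by
    rw [← rngChar_chart hw s ⟨φ, hs⟩, h, rngChar_chart]
  have hdeg : degree s = degree t := congrArg (fun g : X.Gamma => g.1.2.1) h
  rw [degree_eq hs', degree_eq ht'] at hdeg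
  obtain ⟨w, hword⟩ :=
    (at_starMulSelf hs' hs).exists_hasWord_append hw (isSemilatticeFilter_filter φ.1)
  have hword' : X.HasWord (tact hw s φ hs).1.filter (w.append β) :=
    hasWord_act hw hs' φ.1 hs hword
  have h1 := (at_starMulSelf ht' ht).isBeginning hword
  have h2 : LWord.IsBeginning β' (w.append β) := by
    rw [hrng] at hword'
    exact (at_starMulSelf (star_eq ht') (tact_mem_dom hw t φ ht)).isBeginning hword'
  obtain ⟨δ, rfl⟩ := hγ
  rw [LWord.isBeginning_append_iff, ← LWord.isBeginning_append_iff β] at h1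
  have hlen : β'.length = (β ++ δ).length := by
    simp only [List.length_append] at hdeg ⊢
    push_cast at hdeg
    omega
  have h3 : β' = β ++ δ := by
    rw [← h1.eq_take.2, ← h2.eq_take.2, hlen]
  subst h3
  exact ⟨_, (character_mul_iff φ.1).2 ⟨hs, ht⟩, mul_idem_eq_of_append hw hs' ht'⟩

theorem exists_mul_eq_of_chart_eq (hw : X.WeaklyLeftResolving) {s t : X.Semi}
    {φ : X.TightCharacter} (hs : φ ∈ X.dom (X.starMulSelf s)) (ht : φ ∈ X.dom (X.starMulSelf t))
    (h : chart hw s ⟨φ, hs⟩ = chart hw t ⟨φ, ht⟩) :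
    ∃ e : X.Idem, φ ∈ X.dom e ∧ s * e.1 = t * e.1 := by
  obtain ⟨β, A, γ, hs'⟩ := exists_eq_some hs
  obtain ⟨β', A', γ', ht'⟩ := exists_eq_some ht
  rcases (at_starMulSelf hs' hs).prefix_or hw (isSemilatticeFilter_filter φ.1)
    (at_starMulSelf ht' ht) with hγ | hγ
  · exact exists_mul_eq_of_prefix hw hs ht h hs' ht' hγ
  · obtain ⟨e, he, heq⟩ := exists_mul_eq_of_prefix hw ht hs h.symm ht' hs' hγ
    exact ⟨e, he, heq.symm⟩

/-! ### Every element of `Γ` comes from a germ -/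

/-- The condition for `g` to be of the form `(η^{μγ}, |μ| - |ν|, ξ^{νγ})` with
`H_{[μ]γ}(η) = H_{[ν]γ}(ξ)`. -/
def IsShift (g : X.Gamma) (μ ν : List Alph) (γ : LWord Alph) : Prop :=
  X.HasWord g.1.1.1 (γ.append μ) ∧ X.HasWord g.1.2.2.1 (γ.append ν) ∧
    g.1.2.1 = (μ.length : ℤ) - (ν.length : ℤ) ∧ X.cut μ γ g.1.1.1 = X.cut ν γ g.1.2.2.1

/-- The range filter of `g` and the image of its source under `s` have the same word `μγ` and the
same cut at `μ`; gluing recovers both from these data. -/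
theorem IsShift.eq_chart (hw : X.WeaklyLeftResolving) {g : X.Gamma} {μ ν : List Alph}
    {γ : LWord Alph} (hg : IsShift g μ ν γ) {s : X.Semi} {A : Set V} (hs : s.1 = some (μ, A, ν))
    (h : X.srcChar g ∈ X.dom (X.starMulSelf s)) : g = chart hw s ⟨X.srcChar g, h⟩ := by
  obtain ⟨h1, h2, h3, h4⟩ := hg
  rw [← srcChar_filter] at h2 h4
  rw [← rngChar_filter] at h1 h4
  refine gamma_ext ?_ (h3.trans (degree_eq hs).symm) (srcChar_chart hw s ⟨_, h⟩).symm
  rw [rngChar_chart]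
  refine Subtype.ext (filter_injective ?_)
  rw [← glue_cut hw (isSemilatticeFilter_filter _) h1, h4, ← cut_act hw hs _ h h2]
  exact glue_cut hw (isSemilatticeFilter_filter _) (hasWord_act hw hs _ h h2)

theorem isShift_chart (hw : X.WeaklyLeftResolving) {s : X.Semi} {μ ν : List Alph} {A : Set V}
    (hs : s.1 = some (μ, A, ν)) (φ : X.dom (X.starMulSelf s)) :
    ∃ γ, IsShift (chart hw s φ) μ ν γ := by
  obtain ⟨w, hword⟩ :=
    (at_starMulSelf hs φ.2).exists_hasWord_append hw (isSemilatticeFilter_filter φ.1.1)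
  exact ⟨w, hasWord_act hw hs φ.1.1 φ.2 hword, hword, degree_eq hs,
    cut_act hw hs φ.1.1 φ.2 hword⟩

/-- The excluded case is genuine: `r(ω)` is the whole vertex set, which need not belong to the
family. -/
theorem range_inter_range_mem {μ ν : List Alph} {A : Set V} (h : X.IsTriple (μ, A, ν))
    (h0 : ¬ (μ = [] ∧ ν = [])) : X.range μ ∩ X.range ν ∈ X.fam := by
  obtain ⟨h1, h2, -, -, -⟩ := h
  by_cases hμ : μ = []
  · subst hμ
    rw [X.range_nil, Set.univ_inter]
    exact X.range_mem ν h2 fun h => h0 ⟨rfl, h⟩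
  by_cases hν : ν = []
  · subst hν
    rw [X.range_nil, Set.inter_univ]
    exact X.range_mem μ h1 hμ
  exact X.inter_mem _ (X.range_mem μ h1 hμ) _ (X.range_mem ν h2 hν)

/-- A set `C ⊆ r(μ)` at `μ` in the range filter belongs to level zero of the common cut, so it
contains some `D` at `ν` in the source filter. Thus equality of cuts alone makes `(μ, r(μ) ∩ r(ν),
ν)` applicable at the source. -/
theorem IsShift.exists_at (hw : X.WeaklyLeftResolving) {g : X.Gamma} {μ ν : List Alph}
    {γ : LWord Alph} (hg : IsShift g μ ν γ) (h0 : ¬ (μ = [] ∧ ν = [])) :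
    X.At (X.srcChar g).1.filter ν (X.range μ ∩ X.range ν) := by
  obtain ⟨h1, h2, -, h4⟩ := hg
  rw [← srcChar_filter] at h2 h4
  rw [← rngChar_filter] at h1 h4
  have hφ := isSemilatticeFilter_filter (X.srcChar g).1
  have hψ := isSemilatticeFilter_filter (X.rngChar g).1
  have key : ∃ D ⊆ X.range μ, X.At (X.srcChar g).1.filter ν D := by
    by_cases hμ : μ = []
    · subst hμ
      obtain ⟨D, hD⟩ := h2.exists_at (LWord.isBeginning_append_self _ _) fun h => h0 ⟨rfl, h⟩
      exact ⟨D, by simp [X.range_nil], hD⟩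
    · obtain ⟨C, hC⟩ := h1.exists_at (LWord.isBeginning_append_self _ _) hμ
      have hC' := hC.isTriple.2.2.1
      -- Level zero is where the two cuts are compared; for the empty word the range condition on
      -- `C` is vacuous.
      have h5 : X.At (X.cut μ γ (X.rngChar g).1.filter) [] C :=
        (at_cut hw hψ h1).2 ⟨⟨hC'.1, by simp [X.range_nil]⟩, C, subset_rfl, by simpa using hC⟩
      rw [h4, at_cut hw hφ h2, List.append_nil] at h5
      obtain ⟨-, D, hDC, hD⟩ := h5
      exact ⟨D, hDC.trans hC'.2, hD⟩
  obtain ⟨D, hD, hat⟩ := key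
  obtain ⟨-, -, hD', -, hne⟩ := hat.isTriple
  exact hat.mono hw hφ
    ⟨range_inter_range_mem (isTriple_of_subset hD'.1 hD hD'.2 hne) h0, Set.inter_subset_right⟩
    (Set.subset_inter hD hD'.2)

theorem IsShift.exists_chart_of_not_nil (hw : X.WeaklyLeftResolving) {g : X.Gamma}
    {μ ν : List Alph} {γ : LWord Alph} (hg : IsShift g μ ν γ) (h0 : ¬ (μ = [] ∧ ν = [])) :
    ∃ s : X.Semi, s.1 = some (μ, X.range μ ∩ X.range ν, ν) ∧
      X.srcChar g ∈ X.dom (X.starMulSelf s) := by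
  have h1 := hg.exists_at hw h0
  have h2 := h1.isTriple
  refine ⟨X.triple μ _ ν (isTriple_of_subset h2.2.2.1.1 Set.inter_subset_left
    Set.inter_subset_right h2.2.2.2.2), rfl, ?_⟩
  exact h1.mem_of_eq (starMulSelf_eq rfl)

theorem IsShift.eq_of_nil {g : X.Gamma} {γ : LWord Alph} (hg : IsShift g [] [] γ) :
    X.rngChar g = X.srcChar g ∧ g.1.2.1 = 0 := by
  obtain ⟨-, -, h3, h4⟩ := hg
  simp only [cut, if_true] at h4
  refine ⟨congrArg X.toFilterEquiv.symm (Subtype.ext h4), by simpa using h3⟩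

theorem mem_dom_starMulSelf_idem (hw : X.WeaklyLeftResolving) {e : X.Idem} {φ : X.TightCharacter} :
    φ ∈ X.dom (X.starMulSelf e.1) ↔ φ ∈ X.dom e := by
  rw [starMulSelf_idem hw]

theorem tact_idem (hw : X.WeaklyLeftResolving) (e : X.Idem) (φ : X.TightCharacter)
    (h : φ ∈ X.dom (X.starMulSelf e.1)) : tact hw e.1 φ h = φ :=
  Subtype.ext (act_idem hw e φ.1 h)

theorem eq_chart_idem (hw : X.WeaklyLeftResolving) {g : X.Gamma}
    (h : X.rngChar g = X.srcChar g ∧ g.1.2.1 = 0) {e : X.Idem}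
    (he : X.srcChar g ∈ X.dom (X.starMulSelf e.1)) : g = chart hw e.1 ⟨X.srcChar g, he⟩ := by
  refine gamma_ext ?_ (h.2.trans (degree_idem e).symm) (srcChar_chart hw _ ⟨_, he⟩).symm
  rw [rngChar_chart, tact_idem, h.1]

theorem exists_eq_chart (hw : X.WeaklyLeftResolving) (g : X.Gamma) :
    ∃ (s : X.Semi) (h : X.srcChar g ∈ X.dom (X.starMulSelf s)),
      g = chart hw s ⟨X.srcChar g, h⟩ := by
  have hg : ∃ μ ν γ, IsShift g μ ν γ := by
    obtain ⟨α, β, γ, h1, h2, h3, h4⟩ := g.2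
    exact ⟨α, β, γ, h1, h2, h3, h4⟩
  obtain ⟨μ, ν, γ, hg⟩ := hg
  by_cases h0 : μ = [] ∧ ν = []
  · obtain ⟨rfl, rfl⟩ := h0
    obtain ⟨e, he⟩ := (X.srcChar g).1.2.nonzero
    exact ⟨e.1, (mem_dom_starMulSelf_idem hw).2 he, eq_chart_idem hw hg.eq_of_nil _⟩
  · obtain ⟨s, hs, h⟩ := hg.exists_chart_of_not_nil hw h0
    exact ⟨s, h, hg.eq_chart hw hs h⟩

/-! ## The bijection between germs and `Γ` -/

/-- The map that sends the germ `[s, φ]` to the corresponding element of `Γ`. -/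
noncomputable def toGamma (hw : X.WeaklyLeftResolving) : X.TightGroupoid → X.Gamma :=
  Quot.lift (fun p => chart hw p.1.1 ⟨p.1.2, p.2⟩) (by
    rintro ⟨⟨s, φ⟩, hs⟩ ⟨⟨t, ψ⟩, ht⟩ ⟨h1, e, he, h2⟩
    simp only at h1 he h2 hs ht
    subst h1
    exact chart_congr hw hs ht he h2)

theorem toGamma_bijective (hw : X.WeaklyLeftResolving) : Function.Bijective (toGamma hw) := by
  constructor
  · rintro ⟨⟨s, φ⟩, hs⟩ ⟨⟨t, ψ⟩, ht⟩ h
    change chart hw s ⟨φ, hs⟩ = chart hw t ⟨ψ, ht⟩ at h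
    have h1 : φ = ψ := by
      have := congrArg X.srcChar h
      rwa [srcChar_chart, srcChar_chart] at this
    subst h1
    exact Quot.sound ⟨rfl, exists_mul_eq_of_chart_eq hw hs ht h⟩
  · intro g
    obtain ⟨s, h, hg⟩ := exists_eq_chart hw g
    exact ⟨X.germ s _ h, hg.symm⟩

/-- The bijection between the germs and `Γ`. -/
noncomputable def germEquiv (hw : X.WeaklyLeftResolving) : X.TightGroupoid ≃ X.Gamma :=
  Equiv.ofBijective (toGamma hw) (toGamma_bijective hw)

theorem germEquiv_germ (hw : X.WeaklyLeftResolving) (s : X.Semi) (φ : X.TightCharacter)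
    (h : φ ∈ X.dom (X.starMulSelf s)) : germEquiv hw (X.germ s φ h) = chart hw s ⟨φ, h⟩ := rfl

/-- The cut of `ξ` is the cut of its image under `t`, and gluing that recovers the image. -/
theorem isPhi_germEquiv (hw : X.WeaklyLeftResolving) : X.IsPhi (germEquiv hw) := by
  intro t φ h β A γ ht
  obtain ⟨w, hword⟩ :=
    (at_starMulSelf ht h).exists_hasWord_append hw (isSemilatticeFilter_filter φ.1)
  refine ⟨w, hword, ?_, degree_eq ht, rfl⟩
  change (act hw t φ.1 h).filter = X.glue β w (X.cut γ w φ.1.filter)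
  rw [← cut_act hw ht φ.1 h hword]
  exact (glue_cut hw (isSemilatticeFilter_filter _) (hasWord_act hw ht φ.1 h hword)).symm

end LabelledSpace

namespace LabelledSpace

open Topology TopologicalSpace

variable {V Edge Alph : Type*} {X : LabelledSpace V Edge Alph}

/-! ## The topology of the tight spectrum -/

theorem isClopen_dom (e : X.Idem) : IsClopen (X.dom e) :=
  (isClopen_character e).preimage continuous_subtype_val

/-- Being non-zero is not a closed condition in the compact space of all `{0, 1}`-valued maps.
Fixing the value `1` at `e` replaces it by a closed one. -/
theorem isCompact_setOf_character (e : X.Idem) :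
    IsCompact {φ : CharacterSpace X.Idem | φ.1 e = true} := by
  rw [Subtype.isCompact_iff]
  have h1 : Subtype.val '' {φ : CharacterSpace X.Idem | φ.1 e = true} =
      {f : X.Idem → Bool | f 0 = false} ∩ {f | ∀ a b, f (a * b) = (f a && f b)} ∩
        {f | f e = true} := by
    ext f
    constructor
    · rintro ⟨φ, h, rfl⟩
      exact ⟨⟨φ.2.map_zero, φ.2.map_mul⟩, h⟩
    · rintro ⟨⟨h2, h3⟩, h4⟩
      exact ⟨⟨f, h2, h3, e, h4⟩, h4, rfl⟩
  rw [h1]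
  refine IsClosed.isCompact (IsClosed.inter (IsClosed.inter ?_ ?_) ?_)
  · exact isClosed_eq (continuous_apply _) continuous_const
  · simp only [Set.ofPred_forall]
    refine isClosed_iInter fun a => isClosed_iInter fun b => ?_
    refine isClosed_eq (continuous_apply _) ?_
    have h2 : Continuous fun p : Bool × Bool => p.1 && p.2 := continuous_of_discreteTopology
    have h3 : Continuous fun f : X.Idem → Bool => (f a, f b) :=
      (continuous_apply a).prodMk (continuous_apply b)
    exact h2.comp h3
  · exact isClosed_eq (continuous_apply _) continuous_const

theorem isCompact_dom (e : X.Idem) : IsCompact (X.dom e) :=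
  (isClosed_closure.isClosedEmbedding_subtypeVal).isCompact_preimage (isCompact_setOf_character e)

instance : LocallyCompactSpace X.TightCharacter := by
  have : WeaklyLocallyCompactSpace X.TightCharacter := ⟨fun φ => by
    obtain ⟨e, he⟩ := φ.1.2.nonzero
    exact ⟨X.dom e, isCompact_dom e, (isClopen_dom e).2.mem_nhds he⟩⟩
  infer_instance

variable (X) in
/-- The set of tight characters that are `1` at `e` and `0` on `T`. -/
def basicDom (e : X.Idem) (T : Finset X.Idem) : Set X.TightCharacter :=
  {φ | φ ∈ X.dom e ∧ ∀ f ∈ T, φ ∉ X.dom f}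

theorem isClopen_basicDom (e : X.Idem) (T : Finset X.Idem) : IsClopen (X.basicDom e T) := by
  have h : X.basicDom e T = X.dom e ∩ ⋂ f ∈ T, (X.dom f)ᶜ := by
    ext φ
    simp [basicDom]
  rw [h]
  exact (isClopen_dom e).inter (isClopen_biInter_finset fun f _ => (isClopen_dom f).compl)

theorem srcChar_mem_basicDom {g : X.Gamma} {e : X.Idem} {T : Finset X.Idem} :
    X.srcChar g ∈ X.basicDom e T ↔ g.1.2.2 ∈ X.basicSet e T := by
  simp only [basicDom, basicSet, Set.mem_ofPred_eq, mem_dom_iff, srcChar_filter]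

/-- A basic neighbourhood prescribes finitely many values. The prescribed ones collapse to a single
idempotent, their product; the prescribed zeros form `T`. -/
theorem exists_basicDom_subset (hw : X.WeaklyLeftResolving) {U : Set X.TightCharacter}
    (hU : IsOpen U) {φ : X.TightCharacter} (hφ : φ ∈ U) :
    ∃ e T, φ ∈ X.basicDom e T ∧ X.basicDom e T ⊆ U := by
  classical
  obtain ⟨U', hU', rfl⟩ := isOpen_induced_iff.1 hU
  obtain ⟨O, hO, rfl⟩ := isOpen_induced_iff.1 hU'
  obtain ⟨I, u, hu, hI⟩ := isOpen_pi_iff.1 hO _ hφ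
  -- The induction starts from an idempotent where `φ` is `1`, so that the product over an empty
  -- collection also makes sense.
  have hex : ∀ J : Finset X.Idem, ∃ e, φ ∈ X.dom e ∧
      ∀ f ∈ J, φ ∈ X.dom f → X.supp e ⊆ X.supp f := by
    intro J
    induction J using Finset.induction_on with
    | empty =>
      obtain ⟨e, he⟩ := φ.1.2.nonzero
      exact ⟨e, he, by simp⟩
    | insert f J _ ih =>
      obtain ⟨e, he, hJ⟩ := ih
      by_cases hf : φ ∈ X.dom f
      · refine ⟨e * f, (character_mul_iff φ.1).2 ⟨he, hf⟩, fun f' hf' h => ?_⟩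
        rw [supp_mul hw]
        rcases Finset.mem_insert.1 hf' with rfl | hf'
        · exact Set.inter_subset_right
        · exact Set.inter_subset_left.trans (hJ f' hf' h)
      · refine ⟨e, he, fun f' hf' h => ?_⟩
        rcases Finset.mem_insert.1 hf' with rfl | hf'
        · exact absurd h hf
        · exact hJ f' hf' h
  obtain ⟨e, he, hJ⟩ := hex I
  refine ⟨e, I.filter fun f => φ ∉ X.dom f, ⟨he, fun f hf => (Finset.mem_filter.1 hf).2⟩, ?_⟩
  rintro ψ ⟨h1, h2⟩
  refine hI fun f hf => ?_
  have : ψ.1.1 f = φ.1.1 f := by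
    by_cases h : φ ∈ X.dom f
    · have h3 : φ.1.1 f = true := h
      rw [h3]
      exact character_mono hw ψ.1 h1 (hJ f hf h)
    · have h3 : ¬ φ.1.1 f = true := h
      have h4 : ¬ ψ.1.1 f = true := h2 f (Finset.mem_filter.2 ⟨hf, h⟩)
      rw [Bool.not_eq_true] at h3 h4
      rw [h3, h4]
  rw [this]
  exact (hu f hf).2

/-! ## The topology of `Γ` -/

/-- The image in `Γ` of `Θ(s, U)`. -/
def chartSet (hw : X.WeaklyLeftResolving) (s : X.Semi) (U : Set X.TightCharacter) :
    Set X.Gamma :=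
  {g | X.srcChar g ∈ U ∧ ∃ h, g = chart hw s ⟨X.srcChar g, h⟩}

/-- The images in `Γ` of the sets that generate the topology of the groupoid of germs. -/
def chartSets (hw : X.WeaklyLeftResolving) : Set (Set X.Gamma) :=
  {W | ∃ (s : X.Semi) (U : Set X.TightCharacter),
    IsOpen U ∧ U ⊆ X.dom (X.starMulSelf s) ∧ W = chartSet hw s U}

theorem chart_mem_chartSet (hw : X.WeaklyLeftResolving) {s : X.Semi} {U : Set X.TightCharacter}
    (φ : X.dom (X.starMulSelf s)) (h : φ.1 ∈ U) : chart hw s φ ∈ chartSet hw s U := by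
  obtain ⟨φ, hφ⟩ := φ
  have h1 := srcChar_chart hw s ⟨φ, hφ⟩
  refine ⟨by rwa [h1], by rwa [h1], ?_⟩
  congr 2
  exact h1.symm

theorem image_Theta (hw : X.WeaklyLeftResolving) (s : X.Semi) (U : Set X.TightCharacter) :
    (germEquiv hw).symm ⁻¹' X.Theta s U = chartSet hw s U := by
  ext g
  constructor
  · rintro ⟨φ, hφ, h, hg⟩
    rw [Equiv.symm_apply_eq, germEquiv_germ] at hg
    rw [hg]
    exact chart_mem_chartSet hw _ hφ
  · rintro ⟨h1, h2, hg⟩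
    refine ⟨_, h1, h2, ?_⟩
    rw [Equiv.symm_apply_eq, germEquiv_germ]
    exact hg

theorem chartSet_congr (hw : X.WeaklyLeftResolving) {s t : X.Semi} {e : X.Idem}
    (h : s * e.1 = t * e.1) {U : Set X.TightCharacter} (hU : U ⊆ X.dom e)
    (hs : U ⊆ X.dom (X.starMulSelf s)) (ht : U ⊆ X.dom (X.starMulSelf t)) :
    chartSet hw s U = chartSet hw t U := by
  ext g
  constructor
  · rintro ⟨h1, h2, hg⟩
    exact ⟨h1, ht h1, hg.trans (chart_congr hw _ _ (hU h1) h)⟩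
  · rintro ⟨h1, h2, hg⟩
    exact ⟨h1, hs h1, hg.trans (chart_congr hw _ _ (hU h1) h.symm)⟩

theorem chartSet_mono (hw : X.WeaklyLeftResolving) (s : X.Semi) {U U' : Set X.TightCharacter}
    (h : U ⊆ U') : chartSet hw s U ⊆ chartSet hw s U' := fun _ hg => ⟨h hg.1, hg.2⟩

theorem exists_mem_chartSet (hw : X.WeaklyLeftResolving) (g : X.Gamma) :
    ∃ s, g ∈ chartSet hw s (X.dom (X.starMulSelf s)) := by
  obtain ⟨s, h, hg⟩ := exists_eq_chart hw g
  exact ⟨s, h, h, hg⟩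

/-- At a common point of two chart images the germs coincide, so `se = te` for some `e`; both images
then contain the same chart image over `U ∩ U' ∩ D_e`. -/
theorem isTopologicalBasis_chartSets (hw : X.WeaklyLeftResolving) :
    @IsTopologicalBasis _ (X.transportedTopology (germEquiv hw)) (chartSets hw) := by
  let := X.transportedTopology (germEquiv hw)
  refine ⟨?_, ?_, ?_⟩
  · rintro _ ⟨s, U, hU, hUs, rfl⟩ _ ⟨t, U', hU', hUt, rfl⟩ g ⟨⟨h1, h2, h3⟩, k1, k2, k3⟩
    obtain ⟨e, he, hst⟩ := exists_mul_eq_of_chart_eq hw h2 k2 (h3.symm.trans k3)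
    have hs : U ∩ U' ∩ X.dom e ⊆ U := fun φ h => h.1.1
    have ht : U ∩ U' ∩ X.dom e ⊆ U' := fun φ h => h.1.2
    refine ⟨_, ⟨s, U ∩ U' ∩ X.dom e, (hU.inter hU').inter (isClopen_dom e).2, hs.trans hUs, rfl⟩,
      ⟨⟨⟨h1, k1⟩, he⟩, h2, h3⟩, Set.subset_inter (chartSet_mono hw s hs) ?_⟩
    rw [chartSet_congr hw hst Set.inter_subset_right (hs.trans hUs) (ht.trans hUt)]
    exact chartSet_mono hw t ht
  · refine Set.eq_univ_of_forall fun g => ?_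
    obtain ⟨s, hs⟩ := exists_mem_chartSet hw g
    exact ⟨_, ⟨s, _, (isClopen_dom _).2, subset_rfl, rfl⟩, hs⟩
  · change (tightTopology X).coinduced (germEquiv hw) = _
    rw [← Equiv.induced_symm, induced_generateFrom_eq]
    congr 1
    ext W
    constructor
    · rintro ⟨_, ⟨s, U, h1, h2, rfl⟩, rfl⟩
      exact ⟨s, U, h1, h2, image_Theta hw s U⟩
    · rintro ⟨s, U, h1, h2, rfl⟩
      exact ⟨_, ⟨s, U, h1, h2, rfl⟩, image_Theta hw s U⟩

theorem tact_congr (hw : X.WeaklyLeftResolving) (s : X.Semi) {φ ψ : X.TightCharacter} (h : φ = ψ)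
    (hφ : φ ∈ X.dom (X.starMulSelf s)) (hψ : ψ ∈ X.dom (X.starMulSelf s)) :
    tact hw s φ hφ = tact hw s ψ hψ := by
  subst h
  rfl

theorem rngChar_eq_tact (hw : X.WeaklyLeftResolving) {s : X.Semi} {g : X.Gamma}
    {h : X.srcChar g ∈ X.dom (X.starMulSelf s)} (hg : g = chart hw s ⟨X.srcChar g, h⟩) :
    X.rngChar g = tact hw s (X.srcChar g) h :=
  (congrArg X.rngChar hg).trans (rngChar_chart hw s _)

/-! ### Inverses, products and units in charts -/

section

variable {hw : X.WeaklyLeftResolving}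

theorem inv_chart (s : X.Semi) (φ : X.dom (X.starMulSelf s)) :
    X.gammaGroupoid.inv (chart hw s φ) =
      chart hw (star s) ⟨tact hw s φ.1 φ.2, tact_mem_dom hw s φ.1 φ.2⟩ := by
  refine Subtype.ext (Prod.ext ?_ (Prod.ext (degree_star s).symm rfl))
  exact congrArg X.toFilter (tact_star_tact hw s φ.1 φ.2).symm

theorem mul_mem_chartSet {s t : X.Semi} {g h : X.Gamma} (p : X.gammaGroupoid.Comp g h)
    (hg : g ∈ chartSet hw s (X.dom (X.starMulSelf s)))
    (hh : h ∈ chartSet hw t (X.dom (X.starMulSelf t))) :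
    ∃ k, X.gammaGroupoid.mul g h p = chart hw (s * t) ⟨X.srcChar h, k⟩ := by
  obtain ⟨-, h1, h2⟩ := hg
  obtain ⟨-, h3, h4⟩ := hh
  have h5 : X.srcChar g = tact hw t (X.srcChar h) h3 :=
    (congrArg X.toFilterEquiv.symm p).trans (rngChar_eq_tact hw h4)
  have h7 : tact hw t (X.srcChar h) h3 ∈ X.dom (X.starMulSelf s) := h5 ▸ h1
  have h8 : X.srcChar h ∈ X.dom (X.starMulSelf (s * t)) := (starMulSelf_mul_iff hw h3).2 h7
  refine ⟨h8, gamma_ext ?_ ?_ ?_⟩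
  · rw [rngChar_chart]
    change X.rngChar g = _
    rw [rngChar_eq_tact hw h2, tact_congr hw s h5 h1 h7]
    exact Subtype.ext (act_mul hw h8 h3 h7).symm
  · change g.1.2.1 + h.1.2.1 = degree (s * t)
    rw [degree_mul hw h8]
    exact congrArg₂ (· + ·) (congrArg (fun x : X.Gamma => x.1.2.1) h2)
      (congrArg (fun x : X.Gamma => x.1.2.1) h4)
  · rw [srcChar_chart]
    rfl

/-- The unit `(ξ, 0, ξ)`. -/
noncomputable def unitOf (hw : X.WeaklyLeftResolving) (φ : X.TightCharacter) : X.Gamma :=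
  ⟨(X.toFilter φ, 0, X.toFilter φ), by
    obtain ⟨w, hword⟩ := exists_hasWord hw (isSemilatticeFilter_filter φ.1)
    rw [← LWord.append_nil w] at hword
    exact ⟨[], [], w, hword, hword, by simp, rfl⟩⟩

theorem srcChar_unitOf (φ : X.TightCharacter) : X.srcChar (unitOf hw φ) = φ :=
  X.toFilterEquiv.symm_apply_apply _

theorem src_eq_unitOf (g : X.Gamma) : X.gammaGroupoid.src g = unitOf hw (X.srcChar g) := by
  refine Subtype.ext (Prod.ext (toFilter_srcChar g).symm (Prod.ext ?_ (toFilter_srcChar g).symm))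
  exact neg_add_cancel g.1.2.1

/-! ## The sets `Z` -/

theorem mem_Z {s : X.Semi} {μ ν : List Alph} {A : Set V} (hs : s.1 = some (μ, A, ν)) {e : X.Idem}
    {T : Finset X.Idem} {g : X.Gamma} :
    g ∈ X.Z s e T ↔ (∃ γ, IsShift g μ ν γ) ∧ X.srcChar g ∈ X.basicDom e T := by
  rw [srcChar_mem_basicDom]
  constructor
  · rintro ⟨μ', A', ν', γ, h, h1, h2, h3, h4, h5⟩
    rw [hs] at h
    cases h
    exact ⟨⟨γ, h1, h2, h3, h5⟩, h4⟩
  · rintro ⟨⟨γ, h1, h2, h3, h5⟩, h4⟩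
    exact ⟨μ, A, ν, γ, hs, h1, h2, h3, h4, h5⟩

theorem mem_Z_of_mem_dom {s : X.Semi} (hs : s ≠ 0) {e : X.Idem} {T : Finset X.Idem} {g : X.Gamma}
    (h : X.srcChar g ∈ X.dom (X.starMulSelf s)) :
    g ∈ X.Z s e T ↔ g ∈ chartSet hw s (X.basicDom e T) := by
  obtain ⟨μ, A, ν, hs'⟩ := semi_ne_zero_iff.1 hs
  rw [mem_Z hs']
  constructor
  · rintro ⟨⟨γ, h1⟩, h2⟩
    exact ⟨h2, h, h1.eq_chart hw hs' h⟩
  · rintro ⟨h1, h2, h3⟩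
    obtain ⟨γ, h4⟩ := isShift_chart hw hs' ⟨_, h2⟩
    rw [← h3] at h4
    exact ⟨⟨γ, h4⟩, h1⟩

theorem isShift_nil_chart_idem (e : X.Idem) (φ : X.dom (X.starMulSelf e.1)) :
    ∃ γ, IsShift (chart hw e.1 φ) [] [] γ := by
  obtain ⟨w, hword⟩ := exists_hasWord hw (isSemilatticeFilter_filter φ.1.1)
  rw [← LWord.append_nil w] at hword
  have h1 : (chart hw e.1 φ).1.1 = X.toFilter φ.1 := congrArg X.toFilter (tact_idem hw e φ.1 φ.2)
  refine ⟨w, ?_, hword, (degree_idem e).trans (by simp), ?_⟩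
  · rw [h1]
    exact hword
  · rw [h1]
    rfl

/-- Membership in `Z` does not ask that the source contain `s* s`, so the chart of `s` may miss part
of it. The larger triple `(μ, r(μ) ∩ r(ν), ν)` covers all of it; when both words are empty, `Z`
consists of units over `V_{e:T}` and the idempotent `e` itself serves as chart. -/
theorem exists_Z_eq_chartSet {s : X.Semi} (hs : s ≠ 0) (e : X.Idem) (T : Finset X.Idem) :
    ∃ t, X.Z s e T = chartSet hw t (X.basicDom e T ∩ X.dom (X.starMulSelf t)) := by
  obtain ⟨μ, A, ν, hs'⟩ := semi_ne_zero_iff.1 hs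
  by_cases h0 : μ = [] ∧ ν = []
  · refine ⟨e.1, ?_⟩
    obtain ⟨rfl, rfl⟩ := h0
    ext g
    rw [mem_Z hs']
    constructor
    · rintro ⟨⟨γ, h1⟩, h2⟩
      have h3 := (mem_dom_starMulSelf_idem hw).2 h2.1
      exact ⟨⟨h2, h3⟩, h3, eq_chart_idem hw h1.eq_of_nil h3⟩
    · rintro ⟨h1, h2, h3⟩
      obtain ⟨γ, h4⟩ := isShift_nil_chart_idem (hw := hw) e ⟨_, h2⟩
      rw [← h3] at h4
      exact ⟨⟨γ, h4⟩, h1.1⟩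
  · have hA := s.2 _ hs'
    obtain ⟨-, -, hA1, hA2, hA3⟩ := hA
    let t : X.Semi := X.triple μ (X.range μ ∩ X.range ν) ν
      (isTriple_of_subset (range_inter_range_mem (s.2 _ hs') h0) Set.inter_subset_left
        Set.inter_subset_right (hA3.mono (Set.subset_inter hA1.2 hA2.2)))
    have ht : t.1 = some (μ, X.range μ ∩ X.range ν, ν) := rfl
    refine ⟨t, ?_⟩
    ext g
    rw [mem_Z hs']
    constructor
    · rintro ⟨⟨γ, h1⟩, h2⟩
      have h3 : X.srcChar g ∈ X.dom (X.starMulSelf t) :=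
        (h1.exists_at hw h0).mem_of_eq (starMulSelf_eq ht)
      exact ⟨⟨h2, h3⟩, h3, h1.eq_chart hw ht h3⟩
    · rintro ⟨h1, h2, h3⟩
      obtain ⟨γ, h4⟩ := isShift_chart hw ht ⟨_, h2⟩
      rw [← h3] at h4
      exact ⟨⟨γ, h4⟩, h1.1⟩

/-! ## The étale topology -/

variable [TopologicalSpace X.Gamma]

theorem isOpen_chartSet (hB : IsTopologicalBasis (chartSets hw)) {s : X.Semi}
    {U : Set X.TightCharacter} (hU : IsOpen U) (hs : U ⊆ X.dom (X.starMulSelf s)) :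
    IsOpen (chartSet hw s U) := hB.isOpen ⟨s, U, hU, hs, rfl⟩

theorem continuous_of_comp_chart (hB : IsTopologicalBasis (chartSets hw)) {Y : Type*}
    [TopologicalSpace Y] {f : X.Gamma → Y} (h : ∀ s, Continuous fun φ => f (chart hw s φ)) :
    Continuous f := by
  refine continuous_def.2 fun O hO => hB.isOpen_iff.2 fun g hg => ?_
  obtain ⟨s, hs, hgs⟩ := exists_eq_chart hw g
  have h1 := (isClopen_dom (X.starMulSelf s)).2.isOpenMap_subtype_val _ (hO.preimage (h s))
  refine ⟨_, ⟨s, _, h1, ?_, rfl⟩, ⟨⟨⟨X.srcChar g, hs⟩, ?_, rfl⟩, hs, hgs⟩, ?_⟩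
  · rintro _ ⟨φ, -, rfl⟩
    exact φ.2
  · change f _ ∈ O
    rw [← hgs]
    exact hg
  · rintro g' ⟨⟨⟨φ, h2⟩, h3, h4⟩, h5, h6⟩
    simp only at h4
    subst h4
    change f g' ∈ O
    rw [h6]
    exact h3

/-- Where a chart meets the image of another, an idempotent `e` with `se = te` makes the two charts
agree over a neighbourhood inside `D_e`. -/
theorem continuous_chart (hB : IsTopologicalBasis (chartSets hw)) (s : X.Semi) :
    Continuous (chart hw s) := by
  refine hB.continuous_iff.2 ?_
  rintro _ ⟨t, U, hU, hUt, rfl⟩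
  refine isOpen_iff_mem_nhds.2 fun ⟨φ, hφ⟩ ⟨h1, h2, h3⟩ => ?_
  have h4 := srcChar_chart hw s ⟨φ, hφ⟩
  simp only at h4
  rw [h4] at h1
  have h5 : chart hw s ⟨φ, hφ⟩ = chart hw t ⟨φ, hUt h1⟩ := by
    rw [h3]
    congr
  obtain ⟨e, he, hst⟩ := exists_mul_eq_of_chart_eq hw hφ (hUt h1) h5
  have hopen : IsOpen ((Subtype.val : X.dom (X.starMulSelf s) → _) ⁻¹' (U ∩ X.dom e)) :=
    (hU.inter (isClopen_dom e).2).preimage continuous_subtype_val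
  refine Filter.mem_of_superset (hopen.mem_nhds ⟨h1, he⟩) fun ψ hψ => ?_
  change chart hw s ⟨ψ.1, ψ.2⟩ ∈ chartSet hw t U
  rw [chart_congr hw ψ.2 (hUt hψ.1) hψ.2 hst]
  exact chart_mem_chartSet hw _ hψ.1

theorem continuous_srcChar (hB : IsTopologicalBasis (chartSets hw)) : Continuous X.srcChar :=
  continuous_of_comp_chart hB fun s => by
    simp only [srcChar_chart]
    exact continuous_subtype_val

theorem isOpenMap_srcChar (hB : IsTopologicalBasis (chartSets hw)) : IsOpenMap X.srcChar := by
  refine hB.isOpenMap_iff.2 ?_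
  rintro _ ⟨s, U, hU, hUs, rfl⟩
  have : X.srcChar '' chartSet hw s U = U := by
    ext φ
    constructor
    · rintro ⟨g, hg, rfl⟩
      exact hg.1
    · intro hφ
      exact ⟨chart hw s ⟨φ, hUs hφ⟩, chart_mem_chartSet hw _ hφ, srcChar_chart hw s _⟩
  rwa [this]

theorem continuous_inv (hB : IsTopologicalBasis (chartSets hw)) :
    Continuous X.gammaGroupoid.inv :=
  continuous_of_comp_chart hB fun s => by
    simp only [inv_chart]
    exact (continuous_chart hB (star s)).comp ((continuous_tact hw s).subtype_mk _)

theorem isOpenMap_inv (hB : IsTopologicalBasis (chartSets hw)) :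
    IsOpenMap X.gammaGroupoid.inv := by
  intro O hO
  have : X.gammaGroupoid.inv '' O = X.gammaGroupoid.inv ⁻¹' O :=
    congrFun
    (Set.image_eq_preimage_of_inverse X.gammaGroupoid.inv_inv X.gammaGroupoid.inv_inv) O
  rw [this]
  exact hO.preimage (continuous_inv hB)

/-- Near a composable pair lying in the charts of `s` and `t`, the product is the chart of `st` at
the source of the second factor. -/
theorem continuous_mul (hB : IsTopologicalBasis (chartSets hw)) :
    Continuous fun p : {p : X.Gamma × X.Gamma // X.gammaGroupoid.Comp p.1 p.2} =>
      X.gammaGroupoid.mul p.1.1 p.1.2 p.2 := by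
  refine continuous_iff_continuousAt.2 fun p => ?_
  obtain ⟨s, hs⟩ := exists_mem_chartSet hw p.1.1
  obtain ⟨t, ht⟩ := exists_mem_chartSet hw p.1.2
  let N : Set {p : X.Gamma × X.Gamma // X.gammaGroupoid.Comp p.1 p.2} :=
    {p | p.1.1 ∈ chartSet hw s (X.dom (X.starMulSelf s)) ∧
      p.1.2 ∈ chartSet hw t (X.dom (X.starMulSelf t))}
  have hN : IsOpen N :=
    ((isOpen_chartSet hB (isClopen_dom _).2 subset_rfl).preimage
      (continuous_fst.comp continuous_subtype_val)).inter
    ((isOpen_chartSet hB (isClopen_dom _).2 subset_rfl).preimage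
      (continuous_snd.comp continuous_subtype_val))
  refine ContinuousOn.continuousAt (s := N) ?_ (hN.mem_nhds ⟨hs, ht⟩)
  rw [continuousOn_iff_continuous_domRestrict]
  have key : ∀ q : N, ∃ k, X.gammaGroupoid.mul q.1.1.1 q.1.1.2 q.1.2 =
      chart hw (s * t) ⟨X.srcChar q.1.1.2, k⟩ := fun q => mul_mem_chartSet q.1.2 q.2.1 q.2.2
  choose k hk using key
  have h1 : Continuous fun q : N => X.srcChar q.1.1.2 :=
    (continuous_srcChar hB).comp
      (continuous_snd.comp (continuous_subtype_val.comp continuous_subtype_val))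
  exact ((continuous_chart hB (s * t)).comp (h1.subtype_mk k)).congr fun q => (hk q).symm

/-! ## The unit space -/

theorem continuous_unitOf (hB : IsTopologicalBasis (chartSets hw)) :
    Continuous (unitOf hw) := by
  refine continuous_iff_continuousAt.2 fun φ => ?_
  obtain ⟨e, he⟩ := φ.1.2.nonzero
  refine ContinuousOn.continuousAt (s := X.dom e) ?_ ((isClopen_dom e).2.mem_nhds he)
  rw [continuousOn_iff_continuous_domRestrict]
  have h1 : ∀ ψ : X.dom e, ψ.1 ∈ X.dom (X.starMulSelf e.1) := fun ψ =>
    (mem_dom_starMulSelf_idem hw).2 ψ.2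
  refine ((continuous_chart hB e.1).comp (continuous_subtype_val.subtype_mk h1)).congr fun ψ => ?_
  refine Subtype.ext (Prod.ext ?_ (Prod.ext (degree_idem e) rfl))
  exact congrArg X.toFilter (tact_idem hw e ψ.1 _)

/-- The unit space is homeomorphic to the tight spectrum. -/
noncomputable def unitsHomeomorph (hB : IsTopologicalBasis (chartSets hw)) :
    X.gammaGroupoid.units ≃ₜ X.TightCharacter where
  toFun u := X.srcChar u.1
  invFun φ := ⟨unitOf hw φ, unitOf hw φ, by rw [src_eq_unitOf (hw := hw), srcChar_unitOf]⟩
  left_inv := by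
    rintro ⟨_, g, rfl⟩
    refine Subtype.ext ?_
    simp only
    rw [src_eq_unitOf (hw := hw), srcChar_unitOf]
  right_inv φ := srcChar_unitOf (hw := hw) φ
  continuous_toFun := (continuous_srcChar hB).comp continuous_subtype_val
  continuous_invFun := (continuous_unitOf hB).subtype_mk _

/-! ## Bisections -/

/-- On a single chart the source determines the element, and the range determines the source because
`s*` reverses the action. -/
theorem isOpenBisection_of_chart (hB : IsTopologicalBasis (chartSets hw)) {W : Set X.Gamma}
    (hW : IsOpen W) {s : X.Semi} (h : ∀ g ∈ W, ∃ h, g = chart hw s ⟨X.srcChar g, h⟩) :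
    X.gammaGroupoid.IsOpenBisection W := by
  have hsrc : IsOpenEmbedding fun g : W => X.srcChar g.1 := by
    refine .of_continuous_injective_isOpenMap
      ((continuous_srcChar hB).comp continuous_subtype_val) ?_
      ((isOpenMap_srcChar hB).comp hW.isOpenMap_subtype_val)
    intro g g' hgg
    obtain ⟨h1, h2⟩ := h g.1 g.2
    obtain ⟨h3, h4⟩ := h g'.1 g'.2
    refine Subtype.ext ?_
    rw [h2, h4]
    simp only at hgg
    congr
  have hrng : IsOpenEmbedding fun g : W => X.rngChar g.1 := by
    refine .of_continuous_injective_isOpenMap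
      -- The range is the source of the inverse, and inversion is a homeomorphism.
      (((continuous_srcChar hB).comp (continuous_inv hB)).comp continuous_subtype_val) ?_
      (((isOpenMap_srcChar hB).comp (isOpenMap_inv hB)).comp hW.isOpenMap_subtype_val)
    intro g g' hgg
    obtain ⟨h1, h2⟩ := h g.1 g.2
    obtain ⟨h3, h4⟩ := h g'.1 g'.2
    simp only at hgg
    rw [rngChar_eq_tact hw h2, rngChar_eq_tact hw h4] at hgg
    have h6 : X.srcChar g.1 = X.srcChar g'.1 := by
      rw [← tact_star_tact hw s _ h1, ← tact_star_tact hw s _ h3]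
      exact tact_congr hw _ hgg _ _
    exact hsrc.injective h6
  refine ⟨hW, ?_, ?_⟩
  · have h1 : W.domRestrict X.gammaGroupoid.srcMap =
        (unitsHomeomorph hB).symm ∘ fun g : W => X.srcChar g.1 := funext fun g =>
      ((unitsHomeomorph hB).symm_apply_apply (X.gammaGroupoid.srcMap g.1)).symm
    rw [h1]
    exact (unitsHomeomorph hB).symm.isOpenEmbedding.comp hsrc
  · have h1 : W.domRestrict X.gammaGroupoid.rngMap =
        (unitsHomeomorph hB).symm ∘ fun g : W => X.rngChar g.1 := funext fun g =>
      ((unitsHomeomorph hB).symm_apply_apply (X.gammaGroupoid.rngMap g.1)).symm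
    rw [h1]
    exact (unitsHomeomorph hB).symm.isOpenEmbedding.comp hrng

theorem isEtale (hB : IsTopologicalBasis (chartSets hw)) : X.gammaGroupoid.IsEtale where
  continuous_mul := continuous_mul hB
  continuous_inv := continuous_inv hB
  locallyCompact_units := (unitsHomeomorph hB).isClosedEmbedding.locallyCompactSpace
  t2_units := (unitsHomeomorph hB).symm.t2Space
  isLocalHomeomorph_rng := by
    refine isLocalHomeomorph_iff_isOpenEmbedding_restrict.2 fun g => ?_
    obtain ⟨s, hs⟩ := exists_mem_chartSet hw g
    have hopen : IsOpen (chartSet hw s (X.dom (X.starMulSelf s))) :=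
      isOpen_chartSet hB (isClopen_dom _).2 subset_rfl
    exact ⟨_, hopen.mem_nhds hs,
      (isOpenBisection_of_chart hB hopen fun g hg => hg.2).rng_isOpenEmbedding⟩

theorem isCompact_chartSet (hB : IsTopologicalBasis (chartSets hw)) (t : X.Semi)
    {K : Set X.TightCharacter} (hK : IsCompact K) (ht : K ⊆ X.dom (X.starMulSelf t)) :
    IsCompact (chartSet hw t K) := by
  have h1 : chartSet hw t K = chart hw t '' (Subtype.val ⁻¹' K) := by
    ext g
    constructor
    · rintro ⟨h1, h2, h3⟩
      exact ⟨⟨_, h2⟩, h1, h3.symm⟩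
    · rintro ⟨φ, hφ, rfl⟩
      exact chart_mem_chartSet hw φ hφ
  rw [h1]
  refine IsCompact.image ?_ (continuous_chart hB t)
  rw [Subtype.isCompact_iff, Subtype.image_preimage_coe, Set.inter_eq_right.2 ht]
  exact hK

theorem isCompact_isOpen_Z (hB : IsTopologicalBasis (chartSets hw)) {s : X.Semi} (hs : s ≠ 0)
    (e : X.Idem) (T : Finset X.Idem) : IsCompact (X.Z s e T) ∧ IsOpen (X.Z s e T) := by
  obtain ⟨t, ht⟩ := exists_Z_eq_chartSet (hw := hw) hs e T
  rw [ht]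
  refine ⟨isCompact_chartSet hB t ?_ Set.inter_subset_right,
    isOpen_chartSet hB ((isClopen_basicDom e T).2.inter (isClopen_dom _).2)
      Set.inter_subset_right⟩
  exact (isCompact_dom _).inter_left (isClopen_basicDom e T).1

theorem isTopologicalBasis_Z (hB : IsTopologicalBasis (chartSets hw)) :
    IsTopologicalBasis {W : Set X.Gamma | ∃ (s : X.Semi) (e : X.Idem) (T : Finset X.Idem),
      s ≠ 0 ∧ W = X.Z s e T} := by
  refine isTopologicalBasis_of_isOpen_of_nhds ?_ ?_
  · rintro _ ⟨s, e, T, hs, rfl⟩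
    exact (isCompact_isOpen_Z hB hs e T).2
  · intro g O hg hO
    obtain ⟨_, ⟨s, U, hU, hUs, rfl⟩, ⟨h1, h2, h3⟩, hsub⟩ := hB.isOpen_iff.1 hO g hg
    obtain ⟨e, T, h4, h5⟩ := exists_basicDom_subset hw hU h1
    have hs : s ≠ 0 := by
      obtain ⟨β, A, γ, hs⟩ := exists_eq_some h2
      exact semi_ne_zero_iff.2 ⟨β, A, γ, hs⟩
    refine ⟨_, ⟨s, e, T, hs, rfl⟩, (mem_Z_of_mem_dom hs h2).2 ⟨h4, h2, h3⟩, fun g' hg' => ?_⟩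
    obtain ⟨μ, A, ν, hs'⟩ := semi_ne_zero_iff.1 hs
    -- The neighbourhood was chosen inside `U`, hence inside `D_{s* s}`, so here `Z` is the image
    -- under the chart of `s` itself.
    have h6 := h5 ((mem_Z hs').1 hg').2
    exact hsub ⟨h6, ((mem_Z_of_mem_dom hs (hUs h6)).1 hg').2⟩

theorem isOpenBisection_Z (hB : IsTopologicalBasis (chartSets hw)) {s : X.Semi} (hs : s ≠ 0) :
    X.gammaGroupoid.IsOpenBisection (X.Z s (X.starMulSelf s) ∅) := by
  refine isOpenBisection_of_chart hB (isCompact_isOpen_Z hB hs _ _).2 (s := s) fun g hg => ?_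
  obtain ⟨μ, A, ν, hs'⟩ := semi_ne_zero_iff.1 hs
  exact ((mem_Z_of_mem_dom hs ((mem_Z hs').1 hg).2.1).1 hg).2

end

end LabelledSpace

theorem mainTheorem3 {V Edge Alph : Type*} (X : LabelledSpace V Edge Alph)
    (hw : X.WeaklyLeftResolving) (hn : X.Normal) :
    ∃ Φ : X.TightGroupoid ≃ X.Gamma, X.IsPhi Φ ∧
      letI : TopologicalSpace X.Gamma := X.transportedTopology Φ
      TopologicalSpace.IsTopologicalBasis
          {W : Set X.Gamma | ∃ (s : X.Semi) (e : X.Idem) (T : Finset X.Idem), s ≠ 0 ∧ W = X.Z s e T} ∧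
        (∀ (s : X.Semi) (e : X.Idem) (T : Finset X.Idem), s ≠ 0 →
          IsCompact (X.Z s e T) ∧ IsOpen (X.Z s e T)) ∧
        X.gammaGroupoid.IsEtale ∧
        (∀ s : X.Semi, s ≠ 0 →
          IsCompact (X.Z s (X.starMulSelf s) ∅) ∧
            X.gammaGroupoid.IsOpenBisection (X.Z s (X.starMulSelf s) ∅)) := by
  let := X.transportedTopology (LabelledSpace.germEquiv hw)
  have hB := LabelledSpace.isTopologicalBasis_chartSets hw
  exact ⟨LabelledSpace.germEquiv hw, LabelledSpace.isPhi_germEquiv hw,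
    LabelledSpace.isTopologicalBasis_Z hB,
    fun s e T hs => LabelledSpace.isCompact_isOpen_Z hB hs e T,
    LabelledSpace.isEtale hB,
    fun s hs => ⟨(LabelledSpace.isCompact_isOpen_Z hB hs _ _).1,
      LabelledSpace.isOpenBisection_Z hB hs⟩⟩
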